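/- Let $(X,\mathcal X,\mu)$ be a measure space and let $(\mathcal E,\mathcal F)$ be a symmetric Dirichlet form on $L_2(X,\mu;\mathbb R)$, i.e. a nonnegative definite symmetric bilinear form on a dense subspace $\mathcal F$, closed, and such that $u\in\mathcal F$ implies $v:=(0\vee u)\wedge 1\in\mathcal F$ and $\mathcal E(v,v)\le\mathcal E(u,u)$. Let $\mathcal B(\mathcal E)$ be the set of bounded measurable functions $f:X\to\mathbb R$ whose $\mu$-equivalence class lies in $\mathcal F\cap L_1(X,\mu;\mathbb R)$. Assume that $\mathcal B(\mathcal E)$ vanishes nowhere (for every $x\in X$ there is $f\in\mathcal B(\mathcal E)$ with $f(x)\ne 0$) and is separable with respect to the supremum norm. Then the closure $A$ of $\mathcal B(\mathcal E)+i\mathcal B(\mathcal E)$ in the supremum norm is a commutative $C^*$-algebra (with pointwise operations and complex conjugation), and its spectrum $\Delta$, the set of nonzero continuous multiplicative linear functionals on $A$ with the Gelfand (weak-$*$) topology, is a locally compact, second countable Hausdorff space. Write $\hat a(\varphi)=\varphi(a)$ for $a\in A$, $\varphi\in\Delta$. There is a unique Radon measure $\hat\mu$ on $\Delta$ such that $$\int_\Delta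 \hat a\,d\hat\mu=\sup\Big\{\int_X g\,d\mu:\ g\in\mathcal B(\mathcal E),\ 0\le g\le a\Big\}$$ for all $a\in A$ with $a\ge 0$ for which $\hat a$ has compact support. For every $f\in\mathcal B(\mathcal E)$ the function $\hat f$ lies in $L_2(\Delta,\hat\mu;\mathbb R)$, and $$\hat{\mathcal E}(\hat f,\hat g):=\mathcal E(f,g),\qquad f,g\in\mathcal B(\mathcal E),$$ is a well-defined nonnegative definite symmetric bilinear form on the subspace $\hat{\mathcal B}(\mathcal E)=\{\hat f: f\in\mathcal B(\mathcal E)\}$ of $L_2(\Delta,\hat\mu;\mathbb R)$. The form $(\hat{\mathcal E},\hat{\mathcal B}(\mathcal E))$ is closable on $L_2(\Delta,\hat\mu;\mathbb R)$, and its closure $(\hat{\mathcal E},\hat{\mathcal F})$ is a symmetric Dirichlet form on $L_2(\Delta,\hat\mu;\mathbb R)$ that is regular: the set of functions in $C_c(\Delta,\mathbb R)$ whose class lies in $\hat{\mathcal F}$ is dense in $\hat{\mathcal F}$ for the norm $(\hat{\mathcal E}(u,u)+\|u\|_{L_2}^2)^{1/2}$ and dense in $C_c(\Delta,\mathbb R)$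 for the supremum norm. -/

import Mathlib

open MeasureTheory Filter Topology Set
open scoped ENNReal

noncomputable section

namespace GelfandDirichlet

/-- A nonnegative definite symmetric real bilinear form on a linear subspace `dom` of a real normed
space `H`. -/
structure SymForm (H : Type*) [NormedAddCommGroup H] [NormedSpace ℝ H] where
  dom : Submodule ℝ H
  form : dom →ₗ[ℝ] dom →ₗ[ℝ] ℝ
  symm : ∀ u v : dom, form u v = form v u
  nonneg : ∀ u : dom, 0 ≤ form u u

namespace SymForm

variable {H : Type*} [NormedAddCommGroup H] [NormedSpace ℝ H]

/-- The quadratic form `E₁(u) = E(u, u) + ‖u‖²`. -/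
def energyOne (E : SymForm H) (u : E.dom) : ℝ := E.form u u + ‖(u : H)‖ ^ 2

/-- `(E, dom)` is closed: the domain is complete for the norm `E₁(u)^(1/2)`. -/
def IsClosed (E : SymForm H) : Prop :=
  ∀ u : ℕ → E.dom,
    (∀ ε : ℝ, 0 < ε → ∃ N : ℕ, ∀ m, N ≤ m → ∀ n, N ≤ n → E.energyOne (u m - u n) < ε) →
    ∃ v : E.dom, Tendsto (fun n => E.energyOne (u n - v)) atTop (𝓝 0)

/-- `(E, dom)` is closable: every `E`-Cauchy sequence that tends to zero in `H` has energies that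
tend to zero. -/
def IsClosable (E : SymForm H) : Prop :=
  ∀ u : ℕ → E.dom,
    (∀ ε : ℝ, 0 < ε → ∃ N : ℕ, ∀ m, N ≤ m → ∀ n, N ≤ n →
      E.form (u m - u n) (u m - u n) < ε) →
    Tendsto (fun n => (u n : H)) atTop (𝓝 0) →
    Tendsto (fun n => E.form (u n) (u n)) atTop (𝓝 0)

/-- `C` is the closure of `E`: a closed form that extends `E` and in whose domain `dom E` is dense
for the norm `C₁(u)^(1/2)`. These properties determine `C`. -/
structure IsClosureOf (C E : SymForm H) : Prop where
  isClosed : C.IsClosed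
  dom_le : E.dom ≤ C.dom
  form_eq : ∀ u v : E.dom, C.form ⟨u, dom_le u.2⟩ ⟨v, dom_le v.2⟩ = E.form u v
  dense : ∀ u : C.dom, ∀ ε : ℝ, 0 < ε → ∃ v : E.dom, C.energyOne (u - ⟨v, dom_le v.2⟩) < ε

end SymForm

section DirichletForm

variable {X : Type*} [MeasurableSpace X] {μ : Measure X}

/-- A symmetric Dirichlet form on `L₂(X, μ; ℝ)`: a densely defined closed form on which the unit
contraction `u ↦ (0 ∨ u) ∧ 1` operates. -/
structure IsDirichletForm (E : SymForm (Lp ℝ 2 μ)) : Prop where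
  dense : Dense (E.dom : Set (Lp ℝ 2 μ))
  isClosed : E.IsClosed
  markov : ∀ u : E.dom, ∀ v : Lp ℝ 2 μ,
    (v : X → ℝ) =ᵐ[μ] (fun x => min (max ((u : Lp ℝ 2 μ) x) 0) 1) →
    ∃ hv : v ∈ E.dom, E.form ⟨v, hv⟩ ⟨v, hv⟩ ≤ E.form u u

/-- `E` is regular: the continuous compactly supported functions whose class is in the domain are
dense in the domain for the norm `E₁(u)^(1/2)`, and dense in `C_c(X, ℝ)` for the supremum norm. -/
structure IsRegularForm [TopologicalSpace X] (E : SymForm (Lp ℝ 2 μ)) : Prop where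
  dense_dom : ∀ u : E.dom, ∀ ε : ℝ, 0 < ε →
    ∃ g : X → ℝ, Continuous g ∧ HasCompactSupport g ∧
      ∃ v : E.dom, ((v : Lp ℝ 2 μ) : X → ℝ) =ᵐ[μ] g ∧ E.energyOne (u - v) < ε
  dense_sup : ∀ h : X → ℝ, Continuous h → HasCompactSupport h → ∀ ε : ℝ, 0 < ε →
    ∃ g : X → ℝ, Continuous g ∧ HasCompactSupport g ∧
      (∃ v : E.dom, ((v : Lp ℝ 2 μ) : X → ℝ) =ᵐ[μ] g) ∧ ∀ x, |h x - g x| < ε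

/-- The space `B(E)` of bounded measurable functions `f : X → ℝ` (honest functions, not classes)
whose `μ`-class lies in `dom E ∩ L₁(X, μ; ℝ)`. -/
def boundedEnergy (E : SymForm (Lp ℝ 2 μ)) : Set (X → ℝ) :=
  {f | Measurable f ∧ (∃ M : ℝ, ∀ x, |f x| ≤ M) ∧ Integrable f μ ∧
    ∃ u : E.dom, ((u : Lp ℝ 2 μ) : X → ℝ) =ᵐ[μ] f}

/-- A set of functions vanishes nowhere. -/
def VanishesNowhere (B : Set (X → ℝ)) : Prop := ∀ x, ∃ f ∈ B, f x ≠ 0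

/-- A set of functions is separable for the supremum norm. -/
def SupSeparable (B : Set (X → ℝ)) : Prop :=
  ∃ D : Set (X → ℝ), D.Countable ∧ D ⊆ B ∧
    ∀ f ∈ B, ∀ ε : ℝ, 0 < ε → ∃ g ∈ D, ∀ x, |f x - g x| ≤ ε

/-- The complexification `B(E) + i B(E)`, inside the C*-algebra of all bounded functions `X → ℂ`
with pointwise operations, complex conjugation and the supremum norm. -/
def complexification (E : SymForm (Lp ℝ 2 μ)) : Set (lp (fun _ : X => ℂ) ∞) :=
  {a | ∃ f ∈ boundedEnergy E, ∃ g ∈ boundedEnergy E,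
    ∀ x, a x = (f x : ℂ) + Complex.I * (g x : ℂ)}

/-- The C*-algebra `A(B(E))`: the uniformly closed *-algebra generated by `B(E) + i B(E)`. (For a
Dirichlet form it is the uniform closure of `B(E) + i B(E)`, which is part of the theorem.) -/
def uniformAlgebra (E : SymForm (Lp ℝ 2 μ)) :
    NonUnitalStarSubalgebra ℂ (lp (fun _ : X => ℂ) ∞) :=
  (NonUnitalStarAlgebra.adjoin ℂ (complexification E)).topologicalClosure

/-- The Gelfand spectrum `Δ` of `A(B(E))`: its nonzero continuous multiplicative functionals with
the Gelfand (weak-*) topology. -/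
abbrev Spectrum (E : SymForm (Lp ℝ 2 μ)) : Type _ :=
  WeakDual.characterSpace ℂ (uniformAlgebra E)

instance (E : SymForm (Lp ℝ 2 μ)) : MeasurableSpace (Spectrum E) := borel _

instance (E : SymForm (Lp ℝ 2 μ)) : BorelSpace (Spectrum E) := ⟨rfl⟩

theorem zero_mem_boundedEnergy (E : SymForm (Lp ℝ 2 μ)) :
    (fun _ => 0 : X → ℝ) ∈ boundedEnergy E :=
  ⟨measurable_const, ⟨0, fun x => by simp⟩, integrable_zero _ _ _, 0, Lp.coeFn_zero ℝ 2 μ⟩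

theorem memlp_of_mem (E : SymForm (Lp ℝ 2 μ)) (f : boundedEnergy E) :
    Memℓp (fun x => ((f : X → ℝ) x : ℂ)) ∞ := by
  obtain ⟨M, hM⟩ := f.2.2.1
  refine memℓp_infty ⟨M, ?_⟩
  rintro _ ⟨x, rfl⟩
  simpa using hM x

/-- A function in `B(E)` as an element of `A(B(E))`. -/
def toAlgebra (E : SymForm (Lp ℝ 2 μ)) (f : boundedEnergy E) : uniformAlgebra E :=
  ⟨⟨fun x => ((f : X → ℝ) x : ℂ), memlp_of_mem E f⟩,
    subset_closure (NonUnitalStarAlgebra.subset_adjoin ℂ _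
      ⟨f, f.2, _, zero_mem_boundedEnergy E, fun x => by simp⟩)⟩

/-- The Gelfand transform `â(φ) = φ(a)` of `a ∈ A(B(E))`. -/
def gelfand (E : SymForm (Lp ℝ 2 μ)) (a : uniformAlgebra E) (φ : Spectrum E) : ℂ := φ a

/-- The Gelfand transform of `f ∈ B(E)` as a real-valued function on `Δ` (characters of a
C*-algebra are real on its self-adjoint elements). -/
def hat (E : SymForm (Lp ℝ 2 μ)) (f : boundedEnergy E) (φ : Spectrum E) : ℝ :=
  (gelfand E (toAlgebra E f) φ).re

/-- The functional `f ↦ ∫ f dμ`, extended from the nonnegative functions in `B(E)` to those in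
`A(B(E))` by monotone approximation from below. -/
def extendedIntegral (E : SymForm (Lp ℝ 2 μ)) (a : uniformAlgebra E) : ℝ≥0∞ :=
  ⨆ g ∈ {g ∈ boundedEnergy E | ∀ x, 0 ≤ g x ∧ g x ≤ ((a : lp (fun _ : X => ℂ) ∞) x).re},
    ∫⁻ x, ENNReal.ofReal (g x) ∂μ

/-- `ν` is the transferred measure: a Radon measure on `Δ` that represents the functional
`â ↦ extendedIntegral a` on the nonnegative functions in `C_c(Δ)`. -/
structure IsTransferredMeasure (E : SymForm (Lp ℝ 2 μ)) (ν : Measure (Spectrum E)) : Prop where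
  regular : ν.Regular
  represents : ∀ a : uniformAlgebra E,
    (∀ x, 0 ≤ ((a : lp (fun _ : X => ℂ) ∞) x).re ∧ ((a : lp (fun _ : X => ℂ) ∞) x).im = 0) →
    HasCompactSupport (gelfand E a) →
    ∫⁻ φ, ENNReal.ofReal (gelfand E a φ).re ∂ν = extendedIntegral E a

/-- `T` is the transferred form `T(f̂, ĝ) = E(f, g)` on `L₂(Δ, ν; ℝ)`, with domain exactly the set
of classes of the functions `f̂`, `f ∈ B(E)`. -/
structure IsTransferredForm (E : SymForm (Lp ℝ 2 μ)) {ν : Measure (Spectrum E)}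
    (T : SymForm (Lp ℝ 2 ν)) : Prop where
  exists_class : ∀ f : boundedEnergy E,
    ∃ u : T.dom, ((u : Lp ℝ 2 ν) : Spectrum E → ℝ) =ᵐ[ν] hat E f
  mem_dom : ∀ u : Lp ℝ 2 ν, u ∈ T.dom ↔
    ∃ f : boundedEnergy E, (u : Spectrum E → ℝ) =ᵐ[ν] hat E f
  form_eq : ∀ f g : boundedEnergy E, ∀ u v : T.dom, ∀ p q : E.dom,
    ((u : Lp ℝ 2 ν) : Spectrum E → ℝ) =ᵐ[ν] hat E f →
    ((v : Lp ℝ 2 ν) : Spectrum E → ℝ) =ᵐ[ν] hat E g →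
    ((p : Lp ℝ 2 μ) : X → ℝ) =ᵐ[μ] (f : X → ℝ) →
    ((q : Lp ℝ 2 μ) : X → ℝ) =ᵐ[μ] (g : X → ℝ) →
    T.form u v = E.form p q

end DirichletForm

end GelfandDirichlet

end

/-! Evaluation at points gives a map ι from X to Δ (`toSpectrum`) with â ∘ ι = a, and everything on
Δ is transported along it. The measure is the image of μ. Composition with ι is an isometry J from
L₂(Δ) to L₂(X) with J f̂ = f, so the transferred form is a restriction of the pullback of E along J.
The pullback is closed because E is, which yields closability.

Three facts carry the proof. (1) ι has dense range and every function in C_c(Δ) is a Gelfand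
transform (`exists_norm_apply_sub_lt`, `exists_character_apply_eq`). Identities and closed
inequalities between continuous functions on Δ may then be checked on X, and a Radon measure is
determined by its integrals of transforms. (2) On nonnegative elements of A the extended functional
is integration against μ (`extendedIntegral_eq`), so the image measure represents it. (3) The
functions in B(E) with compactly supported transform are E₁-dense in the domain
(`exists_hasCompactSupport_hat_near`). Truncations approximate in L₂ with bounded energies, and a
minimisation based on the parallelogram law upgrades this to E₁
(`IsClosed.exists_mem_dom_of_approx`). Hence the closure is the whole pullback, which inherits the
contraction property from E and is regular.

That the closure of B(E) + iB(E) is an algebra also rests on the unit contraction: it makes B(E)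
stable under f ↦ (f − s)₊, and squares are uniform limits of combinations of such functions. -/

noncomputable section

namespace GelfandDirichlet

/-! ### Characters of a *-algebra of bounded functions with the supremum norm. -/

section FunctionAlgebra

/-- A representation of a normed *-algebra by functions on `X` for which the norm is the supremum
norm. -/
structure FunctionRepresentation (X A : Type*) [NonUnitalNormedRing A] [NormedSpace ℂ A]
    [Star A] where
  eval : A →⋆ₙₐ[ℂ] (X → ℂ)
  norm_eval_le : ∀ a x, ‖eval a x‖ ≤ ‖a‖
  norm_le : ∀ a (c : ℝ), 0 ≤ c → (∀ x, ‖eval a x‖ ≤ c) → ‖a‖ ≤ c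

variable {X A : Type*} [NonUnitalNormedRing A] [NormedSpace ℂ A]

variable (A) in
/-- The characters together with the zero functional: the one-point compactification of the
spectrum. -/
abbrev characterSpaceZero : Set (WeakDual ℂ A) := WeakDual.characterSpace ℂ A ∪ {0}

variable (A) in
/-- The inclusion of the spectrum into its one-point compactification. -/
def toCharacterSpaceZero : WeakDual.characterSpace ℂ A → characterSpaceZero A :=
  Set.inclusion subset_union_left

theorem isOpenEmbedding_toCharacterSpaceZero :
    IsOpenEmbedding (toCharacterSpaceZero A) := by
  refine ⟨IsEmbedding.inclusion subset_union_left, ?_⟩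
  have : range (toCharacterSpaceZero A) = {⟨0, Or.inr rfl⟩}ᶜ := by
    ext ⟨φ, hφ⟩
    simp only [toCharacterSpaceZero, range_inclusion, mem_ofPred_eq, mem_compl_iff,
      mem_singleton_iff]
    exact ⟨fun h h0 => h.1 (congrArg Subtype.val h0),
      fun h => hφ.resolve_right fun h0 => h (Subtype.ext h0)⟩
  rw [this]
  exact isOpen_compl_singleton

theorem continuous_character_apply (a : A) :
    Continuous fun φ : WeakDual.characterSpace ℂ A => φ a :=
  (WeakDual.eval_continuous a).comp continuous_subtype_val

theorem isInducing_character_apply :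
    IsInducing fun (φ : WeakDual.characterSpace ℂ A) (a : A) => φ a :=
  IsInducing.comp (g := fun (φ : WeakDual ℂ A) (a : A) => φ a) ⟨rfl⟩ IsInducing.subtypeVal

variable [StarRing A]

/-- A nonzero character is approximated by point evaluations on finitely many elements. -/
theorem FunctionRepresentation.exists_norm_apply_sub_lt (e : FunctionRepresentation X A)
    (φ : WeakDual.characterSpace ℂ A) (s : Finset A) {ε : ℝ}
    (hε : 0 < ε) : ∃ x, ∀ a ∈ s, ‖φ a - e.eval a x‖ < ε := by
  -- Otherwise b ≥ ε² on X for the sum b of squared deviations. Multiplication by 1 − b/R then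
  -- shrinks norms by a factor q < 1 but is invisible to φ, which forces φ = 0.
  by_contra! hcon
  set b : X → ℝ := fun x => ∑ a ∈ s, ‖φ a - e.eval a x‖ ^ 2 with hb
  -- The summand ε² gives R > 0 and ε² ≤ R even when `s` or X is empty.
  set R : ℝ := ∑ a ∈ s, (‖φ a‖ + ‖a‖) ^ 2 + ε ^ 2 with hR
  have hRpos : 0 < R := by positivity
  have hbR : ∀ x, b x ≤ R := by
    intro x
    have : b x ≤ ∑ a ∈ s, (‖φ a‖ + ‖a‖) ^ 2 := by
      refine Finset.sum_le_sum fun a _ => ?_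
      have := norm_sub_le (φ a) (e.eval a x)
      have := e.norm_eval_le a x
      gcongr
      linarith
    nlinarith [sq_nonneg ε]
  have hεb : ∀ x, ε ^ 2 ≤ b x := by
    intro x
    obtain ⟨a, ha, hax⟩ := hcon x
    calc ε ^ 2 ≤ ‖φ a - e.eval a x‖ ^ 2 := by gcongr
      _ ≤ b x := Finset.single_le_sum
        (f := fun a : A => ‖φ a - e.eval a x‖ ^ 2)
        (fun a _ => by positivity) ha
  -- Multiplication by b, written without a unit since b itself need not lie in A. Each a * v − φ(a)
  -- v is killed by φ, so φ ∘ T = 0 without knowing φ(star a).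
  set T : A → A := fun v =>
    ∑ a ∈ s, (star a * (a * v - φ a • v) - (starRingEnd ℂ (φ a)) • (a * v - φ a • v)) with hT
  set L : A → A := fun v => v - ((R⁻¹ : ℝ) : ℂ) • T v with hL
  have hφT : ∀ v, φ (T v) = 0 := by
    intro v
    simp only [hT, map_sum]
    refine Finset.sum_eq_zero fun a _ => ?_
    simp [map_sub, map_mul, map_smul]
  have hφL : ∀ v, φ (L v) = φ v := by
    intro v
    simp only [hL, map_sub, map_smul, hφT, smul_zero, sub_zero]
  have hTx : ∀ v x, e.eval (T v) x = (b x : ℂ) * e.eval v x := by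
    intro v x
    simp only [hT, hb, map_sum, Finset.sum_apply]
    push_cast
    rw [Finset.sum_mul]
    refine Finset.sum_congr rfl fun a _ => ?_
    have : ((‖φ a - e.eval a x‖ : ℂ)) ^ 2
        = (φ a - e.eval a x) * starRingEnd ℂ (φ a - e.eval a x) := by
      rw [Complex.mul_conj, Complex.normSq_eq_norm_sq]; push_cast; rfl
    rw [this]
    simp [map_sub, map_mul, map_smul, map_star]
    ring
  have hLx : ∀ v x, e.eval (L v) x = ((1 - R⁻¹ * b x : ℝ) : ℂ) * e.eval v x := by
    intro v x
    have : e.eval (L v) x = e.eval v x - ((R⁻¹ : ℝ) : ℂ) * e.eval (T v) x := by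
      simp [hL]
    rw [this, hTx]
    push_cast
    ring
  set q : ℝ := 1 - R⁻¹ * ε ^ 2 with hq
  have hq1 : q < 1 := by
    have : 0 < R⁻¹ * ε ^ 2 := by positivity
    linarith
  have hfac : ∀ x, 0 ≤ 1 - R⁻¹ * b x ∧ 1 - R⁻¹ * b x ≤ q := by
    intro x
    have h1 : R⁻¹ * b x ≤ R⁻¹ * R := by gcongr; exact hbR x
    rw [inv_mul_cancel₀ hRpos.ne'] at h1
    have h2 : R⁻¹ * ε ^ 2 ≤ R⁻¹ * b x := by gcongr; exact hεb x
    constructor <;> linarith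
  have hq0 : 0 ≤ q := by
    have h1 : R⁻¹ * ε ^ 2 ≤ R⁻¹ * R := by
      gcongr
      simp only [hR]
      have : 0 ≤ ∑ a ∈ s, (‖φ a‖ + ‖a‖) ^ 2 := by positivity
      linarith
    rw [inv_mul_cancel₀ hRpos.ne'] at h1
    linarith
  have hLn : ∀ v, ‖L v‖ ≤ q * ‖v‖ := by
    intro v
    refine e.norm_le _ _ (by positivity) fun x => ?_
    rw [hLx, norm_mul, Complex.norm_real, Real.norm_of_nonneg (hfac x).1]
    exact mul_le_mul (hfac x).2 (e.norm_eval_le v x) (norm_nonneg _) hq0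
  set Φ : A →L[ℂ] ℂ := WeakDual.CharacterSpace.toCLM φ with hΦ
  have h1 : ‖Φ‖ ≤ q * ‖Φ‖ := by
    refine ContinuousLinearMap.opNorm_le_bound _ (by positivity) fun v => ?_
    have : Φ v = Φ (L v) := (hφL v).symm
    rw [this]
    calc ‖Φ (L v)‖ ≤ ‖Φ‖ * ‖L v‖ := Φ.le_opNorm _
      _ ≤ ‖Φ‖ * (q * ‖v‖) := by gcongr; exact hLn v
      _ = q * ‖Φ‖ * ‖v‖ := by ring
  have h2 : ‖Φ‖ = 0 := by nlinarith [norm_nonneg Φ]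
  exact φ.2.1 (norm_eq_zero.mp h2)

theorem FunctionRepresentation.norm_character_apply_le (e : FunctionRepresentation X A)
    (φ : WeakDual.characterSpace ℂ A) (a : A) : ‖φ a‖ ≤ ‖a‖ := by
  refine le_of_forall_pos_le_add fun ε hε => ?_
  obtain ⟨x, hx⟩ := e.exists_norm_apply_sub_lt φ {a} hε
  have h1 := hx a (by simp)
  have h2 := e.norm_eval_le a x
  have h3 := norm_sub_norm_le (φ a) (e.eval a x)
  linarith

/-- Point evaluations respect the involution, and one point approximates φ at `a` and `star a`
simultaneously. -/
theorem FunctionRepresentation.character_star (e : FunctionRepresentation X A)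
    (φ : WeakDual.characterSpace ℂ A) (a : A) : φ (star a) = starRingEnd ℂ (φ a) := by
  classical
  refine eq_of_forall_dist_le fun ε hε => ?_
  obtain ⟨x, hx⟩ := e.exists_norm_apply_sub_lt φ {a, star a} (half_pos hε)
  have h1 := hx a (by simp)
  have h2 := hx (star a) (by simp)
  rw [← Complex.norm_conj, map_sub] at h1
  have h3 : e.eval (star a) x = starRingEnd ℂ (e.eval a x) := by rw [map_star]; rfl
  rw [h3] at h2
  rw [dist_eq_norm]
  have h4 := norm_sub_le (φ (star a) - starRingEnd ℂ (e.eval a x))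
    (starRingEnd ℂ (φ a) - starRingEnd ℂ (e.eval a x))
  rw [sub_sub_sub_cancel_right] at h4
  linarith

/-- Banach–Alaoglu: characters are contractive, so adjoining zero gives a weak-* closed subset of
the unit ball. -/
theorem FunctionRepresentation.compactSpace_characterSpaceZero (e : FunctionRepresentation X A) :
    CompactSpace (characterSpaceZero A) := by
  refine isCompact_iff_compactSpace.mp (WeakDual.isCompact_of_bounded_of_closed ?_
    (WeakDual.CharacterSpace.union_zero_isClosed ℂ A))
  refine (WeakDual.isBounded_closedBall (0 : StrongDual ℂ A) 1).subset ?_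
  rintro φ (hφ | rfl)
  · simp only [mem_preimage, mem_closedBall_zero_iff]
    refine ContinuousLinearMap.opNorm_le_bound _ zero_le_one fun a => ?_
    rw [one_mul]
    exact e.norm_character_apply_le ⟨φ, hφ⟩ a
  · simp

theorem FunctionRepresentation.locallyCompactSpace_characterSpace
    (e : FunctionRepresentation X A) : LocallyCompactSpace (WeakDual.characterSpace ℂ A) :=
  have := e.compactSpace_characterSpaceZero
  isOpenEmbedding_toCharacterSpaceZero.locallyCompactSpace

/-- Weak-* compact subsets of the dual of a separable space are metrizable. -/
theorem FunctionRepresentation.secondCountableTopology_characterSpace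
    (e : FunctionRepresentation X A) [TopologicalSpace.SeparableSpace A] :
    SecondCountableTopology (WeakDual.characterSpace ℂ A) := by
  have hcpt := e.compactSpace_characterSpaceZero
  have := WeakDual.metrizable_of_isCompact ℂ A _ (isCompact_iff_compactSpace.mpr hcpt)
  have : SecondCountableTopology (characterSpaceZero A) := by
    let := TopologicalSpace.metrizableSpaceMetric (characterSpaceZero A)
    infer_instance
  exact isOpenEmbedding_toCharacterSpaceZero.isEmbedding.secondCountableTopology

/-- Gelfand transforms vanish at infinity. -/
theorem FunctionRepresentation.isCompact_le_norm_character_apply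
    (e : FunctionRepresentation X A) (a : A) {ε : ℝ} (hε : 0 < ε) :
    IsCompact {φ : WeakDual.characterSpace ℂ A | ε ≤ ‖φ a‖} := by
  have := e.compactSpace_characterSpaceZero
  rw [isOpenEmbedding_toCharacterSpaceZero.isInducing.isCompact_iff]
  -- Since ε > 0, the zero functional is excluded automatically, and the set is closed in the
  -- compactification.
  have : toCharacterSpaceZero A '' {φ | ε ≤ ‖φ a‖} =
      {φ : characterSpaceZero A | ε ≤ ‖(φ : WeakDual ℂ A) a‖} := by
    ext ⟨φ, hφ⟩
    constructor
    · rintro ⟨ψ, hψ, h⟩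
      rw [← h]
      exact hψ
    · intro h
      refine ⟨⟨φ, hφ.resolve_right ?_⟩, h, rfl⟩
      rintro rfl
      simp only [mem_ofPred_eq] at h
      have : ‖(0 : WeakDual ℂ A) a‖ = 0 := norm_zero
      linarith
  rw [this]
  refine IsClosed.isCompact (isClosed_le continuous_const ?_)
  exact ((WeakDual.eval_continuous a).comp continuous_subtype_val).norm

/-- The evaluation at a point, as a character. -/
def FunctionRepresentation.pointCharacter (e : FunctionRepresentation X A)
    (hne : ∀ x, ∃ a, e.eval a x ≠ 0) (x : X) : WeakDual.characterSpace ℂ A :=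
  ⟨StrongDual.toWeakDual (LinearMap.mkContinuous
    { toFun := fun a : A => e.eval a x
      map_add' := fun a b => by simp
      map_smul' := fun c a => by simp } 1
    (fun a => by rw [one_mul]; exact e.norm_eval_le a x)), by
    obtain ⟨a, ha⟩ := hne x
    refine ⟨fun h => ha (DFunLike.congr_fun h a), fun a b => ?_⟩
    change e.eval (a * b) x = e.eval a x * e.eval b x
    rw [map_mul, Pi.mul_apply]⟩

theorem FunctionRepresentation.pointCharacter_apply (e : FunctionRepresentation X A)
    (hne : ∀ x, ∃ a, e.eval a x ≠ 0) (x : X) (a : A) :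
    e.pointCharacter hne x a = e.eval a x := rfl

theorem FunctionRepresentation.denseRange_pointCharacter (e : FunctionRepresentation X A)
    (hne : ∀ x, ∃ a, e.eval a x ≠ 0) : DenseRange (e.pointCharacter hne) := by
  intro φ
  rw [isInducing_character_apply.closure_eq_preimage_closure_image, mem_preimage,
    mem_closure_iff_nhds_basis
    (by rw [nhds_pi]; exact hasBasis_pi fun a => Metric.nhds_basis_ball)]
  rintro ⟨I, r⟩ ⟨hI, hr⟩
  obtain ⟨ε, hε, hεr⟩ : ∃ ε : ℝ, 0 < ε ∧ ∀ i ∈ I, ε ≤ r i := by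
    rcases I.eq_empty_or_nonempty with rfl | hne
    · exact ⟨1, one_pos, by simp⟩
    · obtain ⟨i, hi, hmin⟩ := Set.exists_min_image I r hI hne
      exact ⟨r i, hr i hi, hmin⟩
  obtain ⟨x, hx⟩ := e.exists_norm_apply_sub_lt φ hI.toFinset hε
  refine ⟨_, ⟨_, ⟨x, rfl⟩, rfl⟩, fun a ha => ?_⟩
  rw [Metric.mem_ball', dist_eq_norm]
  exact (hx a (by simpa using ha)).trans_le (hεr a ha)

/-- The functions on the compactified spectrum that are sums of a Gelfand transform and a
constant. -/
def FunctionRepresentation.gelfandAddConst (e : FunctionRepresentation X A) :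
    StarSubalgebra ℂ C(characterSpaceZero A, ℂ) where
  carrier := {k | ∃ (a : A) (c : ℂ), ∀ φ, k φ = (φ : WeakDual ℂ A) a + c}
  mul_mem' := by
    rintro k l ⟨a, c, hk⟩ ⟨b, d, hl⟩
    refine ⟨a * b + d • a + c • b, c * d, fun φ => ?_⟩
    have hmul : (φ : WeakDual ℂ A) (a * b) = (φ : WeakDual ℂ A) a * (φ : WeakDual ℂ A) b :=
      ((WeakDual.CharacterSpace.union_zero ℂ A).subset φ.2) a b
    rw [ContinuousMap.mul_apply, hk, hl, map_add, map_add, map_smul, map_smul, hmul]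
    simp only [smul_eq_mul]
    ring
  add_mem' := by
    rintro k l ⟨a, c, hk⟩ ⟨b, d, hl⟩
    refine ⟨a + b, c + d, fun φ => ?_⟩
    rw [ContinuousMap.add_apply, hk, hl, map_add]
    ring
  algebraMap_mem' c := ⟨0, c, fun φ => by rw [map_zero]; simp⟩
  star_mem' := by
    rintro k ⟨a, c, hk⟩
    refine ⟨star a, star c, fun φ => ?_⟩
    have hstar : (φ : WeakDual ℂ A) (star a) = star ((φ : WeakDual ℂ A) a) := by
      obtain ⟨φ, hφ | rfl⟩ := φ
      · exact e.character_star ⟨φ, hφ⟩ a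
      · exact (star_zero ℂ).symm
    rw [ContinuousMap.star_apply, hk, star_add, hstar]

/-- Every compactly supported continuous function on the spectrum is uniformly close to a Gelfand
transform. -/
theorem FunctionRepresentation.exists_norm_sub_character_apply_le
    (e : FunctionRepresentation X A) {h : WeakDual.characterSpace ℂ A → ℂ}
    (hc : Continuous h) (hs : HasCompactSupport h) {ε : ℝ} (hε : 0 < ε) :
    ∃ a : A, ∀ φ : WeakDual.characterSpace ℂ A, ‖h φ - φ a‖ ≤ ε := by
  classical
  have := e.compactSpace_characterSpaceZero
  set z : characterSpaceZero A := ⟨0, Or.inr rfl⟩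
  have hemb := isOpenEmbedding_toCharacterSpaceZero (A := A)
  have hz : z ∉ range (toCharacterSpaceZero A) := by
    rintro ⟨φ, hφ⟩
    exact φ.2.1 (congrArg Subtype.val hφ)
  set H : characterSpaceZero A → ℂ := Function.extend (toCharacterSpaceZero A) h 0
  have hHval : ∀ φ, H (toCharacterSpaceZero A φ) = h φ := hemb.injective.extend_apply h 0
  have hHz : H z = 0 := Function.extend_apply' _ _ _ (fun ⟨φ, hφ⟩ => hz ⟨φ, hφ⟩)
  -- Continuity need only be checked on the closed support, which lies in the open copy of the
  -- spectrum.
  have hHc : Continuous H := by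
    refine continuous_of_tsupport fun y hy => ?_
    obtain ⟨φ, -, rfl⟩ := hs.tsupport_extend_zero_subset hemb.continuous hy
    rw [← hemb.continuousAt_iff, show H ∘ toCharacterSpaceZero A = h from funext hHval]
    exact hc.continuousAt
  obtain ⟨k, ⟨a, c, hk⟩, hkH⟩ :
      ∃ k ∈ e.gelfandAddConst, ‖(⟨H, hHc⟩ : C(_, ℂ)) - k‖ < ε / 2 := by
    have hsep : (e.gelfandAddConst).SeparatesPoints := by
      intro φ ψ hne
      obtain ⟨a, ha⟩ : ∃ a, (φ : WeakDual ℂ A) a ≠ (ψ : WeakDual ℂ A) a := by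
        by_contra! hcon
        exact hne (Subtype.ext (DFunLike.ext _ _ hcon))
      exact ⟨_, ⟨⟨fun φ => (φ : WeakDual ℂ A) a,
        (WeakDual.eval_continuous a).comp continuous_subtype_val⟩, ⟨a, 0, fun φ => by simp⟩,
        rfl⟩, ha⟩
    have htop := ContinuousMap.starSubalgebra_topologicalClosure_eq_top_of_separatesPoints _ hsep
    have hmem : (⟨H, hHc⟩ : C(characterSpaceZero A, ℂ)) ∈
        (e.gelfandAddConst).topologicalClosure := by rw [htop]; trivial
    obtain ⟨k, hk, hd⟩ := Metric.mem_closure_iff.mp hmem (ε / 2) (half_pos hε)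
    exact ⟨k, hk, by rwa [← dist_eq_norm]⟩
  have hall : ∀ φ, ‖H φ - k φ‖ ≤ ε / 2 := fun φ =>
    (ContinuousMap.norm_coe_le_norm ((⟨H, hHc⟩ : C(_, ℂ)) - k) φ).trans hkH.le
  -- At the zero functional H vanishes and k equals c, so the constant is small and can be dropped.
  have hcn : ‖c‖ ≤ ε / 2 := by
    have := hall z
    rw [hHz, hk] at this
    have h0 : (z : WeakDual ℂ A) a = 0 := rfl
    rwa [h0, zero_add, zero_sub, norm_neg] at this
  refine ⟨a, fun φ => ?_⟩
  have h1 := hall (toCharacterSpaceZero A φ)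
  rw [hHval, hk] at h1
  have h2 : ((toCharacterSpaceZero A φ : characterSpaceZero A) : WeakDual ℂ A) a = φ a := rfl
  rw [h2] at h1
  have h3 := norm_add_le (h φ - (φ a + c)) c
  rw [show h φ - (φ a + c) + c = h φ - φ a by ring] at h3
  linarith

/-- Every compactly supported continuous function on the spectrum of a complete algebra is a
Gelfand transform. -/
theorem FunctionRepresentation.exists_character_apply_eq [CompleteSpace A]
    (e : FunctionRepresentation X A) (hne : ∀ x, ∃ a, e.eval a x ≠ 0)
    {h : WeakDual.characterSpace ℂ A → ℂ} (hc : Continuous h) (hs : HasCompactSupport h) :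
    ∃ a : A, ∀ φ : WeakDual.characterSpace ℂ A, φ a = h φ := by
  choose a ha using fun n : ℕ =>
    e.exists_norm_sub_character_apply_le hc hs (Nat.one_div_pos_of_nat (α := ℝ) (n := n))
  have hlim : Tendsto (fun n : ℕ => (1 : ℝ) / (n + 1)) atTop (𝓝 0) :=
    tendsto_one_div_add_atTop_nhds_zero_nat
  -- The norm of A is a supremum over X, so estimates at point characters suffice.
  have hcau : CauchySeq a := by
    refine cauchySeq_of_le_tendsto_0' (fun n : ℕ => 2 * ((1 : ℝ) / (n + 1))) (fun n m hnm => ?_)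
      (by simpa using hlim.const_mul 2)
    rw [dist_eq_norm]
    refine e.norm_le _ _ (by positivity) fun x => ?_
    have h1 := ha n (e.pointCharacter hne x)
    have h2 := ha m (e.pointCharacter hne x)
    rw [e.pointCharacter_apply] at h1 h2
    have h3 : (1 : ℝ) / (m + 1) ≤ 1 / (n + 1) := by gcongr
    have h4 := norm_sub_le (h (e.pointCharacter hne x) - e.eval (a m) x)
      (h (e.pointCharacter hne x) - e.eval (a n) x)
    rw [sub_sub_sub_cancel_left] at h4
    rw [map_sub, Pi.sub_apply]
    linarith
  obtain ⟨b, hb⟩ := cauchySeq_tendsto_of_complete hcau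
  refine ⟨b, fun φ => tendsto_nhds_unique
    ((map_continuous φ).continuousAt.tendsto.comp hb) ?_⟩
  rw [tendsto_iff_norm_sub_tendsto_zero]
  refine squeeze_zero (fun _ => norm_nonneg _) (fun n => ?_) hlim
  rw [norm_sub_rev]
  exact ha n φ

end FunctionAlgebra

/-! ### Closed forms and the parallelogram law. -/

namespace SymForm

variable {H : Type*} [NormedAddCommGroup H] [NormedSpace ℝ H] (E : SymForm H)

theorem form_smul_smul (c : ℝ) (u : E.dom) : E.form (c • u) (c • u) = c ^ 2 * E.form u u := by
  simp only [map_smul, LinearMap.smul_apply, smul_eq_mul]; ring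

theorem form_neg_neg (u : E.dom) : E.form (-u) (-u) = E.form u u := by simp

theorem form_add_add_form_sub_sub (u v : E.dom) :
    E.form (u + v) (u + v) + E.form (u - v) (u - v) = 2 * E.form u u + 2 * E.form v v := by
  simp only [map_add, map_sub, LinearMap.add_apply, LinearMap.sub_apply]; ring

theorem form_sub_sub_le (u v : E.dom) :
    E.form (u - v) (u - v) ≤ 2 * E.form u u + 2 * E.form v v := by
  linarith [E.form_add_add_form_sub_sub u v, E.nonneg (u + v)]

theorem form_le_energyOne (u : E.dom) : E.form u u ≤ E.energyOne u :=
  le_add_of_nonneg_right (sq_nonneg _)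

theorem norm_sq_le_energyOne (u : E.dom) : ‖(u : H)‖ ^ 2 ≤ E.energyOne u :=
  le_add_of_nonneg_left (E.nonneg u)

theorem energyOne_neg (u : E.dom) : E.energyOne (-u) = E.energyOne u := by
  simp [energyOne]

theorem energyOne_sub_comm (u v : E.dom) : E.energyOne (u - v) = E.energyOne (v - u) := by
  rw [← energyOne_neg, neg_sub]

theorem tendsto_of_tendsto_energyOne {E : SymForm H} {u : ℕ → E.dom} {v : E.dom}
    (h : Tendsto (fun n => E.energyOne (u n - v)) atTop (𝓝 0)) :
    Tendsto (fun n => (u n : H)) atTop (𝓝 (v : H)) := by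
  rw [tendsto_iff_norm_sub_tendsto_zero]
  have h1 : Tendsto (fun n => ‖(u n : H) - v‖ ^ 2) atTop (𝓝 0) :=
    squeeze_zero (fun _ => sq_nonneg _) (fun n => E.norm_sq_le_energyOne (u n - v)) h
  have h2 := (Real.continuous_sqrt.tendsto 0).comp h1
  simpa [Function.comp_def, Real.sqrt_sq (norm_nonneg _)] using h2

/-- A form that has a closed extension is closable. -/
theorem IsClosable.of_isClosed {E T : SymForm H} (hE : E.IsClosed) (hle : T.dom ≤ E.dom)
    (hform : ∀ u : T.dom, E.form ⟨u, hle u.2⟩ ⟨u, hle u.2⟩ = T.form u u) : T.IsClosable := by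
  intro u hu hu0
  set w : ℕ → E.dom := fun n => ⟨u n, hle (u n).2⟩ with hw
  have hdiff : ∀ m n, E.form (w m - w n) (w m - w n) = T.form (u m - u n) (u m - u n) :=
    fun m n => hform (u m - u n)
  obtain ⟨v, hv⟩ := hE w (by
    intro ε hε
    obtain ⟨N, hN⟩ := hu (ε / 2) (half_pos hε)
    have hcau := hu0.cauchySeq
    obtain ⟨N', hN'⟩ := Metric.cauchySeq_iff.mp hcau (Real.sqrt (ε / 2))
      (Real.sqrt_pos.mpr (half_pos hε))
    refine ⟨max N N', fun m hm n hn => ?_⟩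
    have h1 := hN m (le_of_max_le_left hm) n (le_of_max_le_left hn)
    have h2 := hN' m (le_of_max_le_right hm) n (le_of_max_le_right hn)
    rw [dist_eq_norm] at h2
    have h3 : ‖(u m : H) - u n‖ ^ 2 < ε / 2 := by
      rwa [Real.lt_sqrt (norm_nonneg _)] at h2
    have h4 : E.energyOne (w m - w n) = T.form (u m - u n) (u m - u n) + ‖(u m : H) - u n‖ ^ 2 := by
      rw [energyOne, hdiff]; rfl
    linarith)
  have hv0 : v = 0 := Subtype.ext (tendsto_nhds_unique (tendsto_of_tendsto_energyOne hv) hu0)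
  rw [hv0] at hv
  refine squeeze_zero (fun n => T.nonneg _) (fun n => ?_) hv
  rw [← hform, sub_zero]
  exact E.form_le_energyOne (w n)

/-- If elements of a convex subset of the domain with bounded energies approximate `u` in the
ambient space, then `u` belongs to the domain and to the closure of the set for the norm
`E₁(u)^(1/2)`. -/
theorem IsClosed.exists_mem_dom_of_approx {E : SymForm H} (hE : E.IsClosed) {K : Set E.dom}
    (hK : ∀ v ∈ K, ∀ w ∈ K, (2⁻¹ : ℝ) • (v + w) ∈ K) {u : H} {M : ℝ}
    (happ : ∀ δ : ℝ, 0 < δ → ∃ w ∈ K, ‖(w : H) - u‖ ≤ δ ∧ E.form w w ≤ M) :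
    ∃ hu : u ∈ E.dom, ∀ ε : ℝ, 0 < ε → ∃ w ∈ K, E.energyOne (⟨u, hu⟩ - w) < ε := by
  -- Minimisation takes the place of weak compactness. The infimum d n of the energies over K within
  -- distance 1/(n+1) of u increases and is bounded by M. Midpoints of near-minimisers stay in S n
  -- and so have energy at least d n, which by the parallelogram law makes the near-minimisers
  -- E₁-Cauchy.
  set S : ℕ → Set E.dom := fun n => {w | w ∈ K ∧ ‖(w : H) - u‖ ≤ 1 / (n + 1)} with hS
  set d : ℕ → ℝ := fun n => sInf ((fun w => E.form w w) '' S n) with hd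
  have hlim : Tendsto (fun n : ℕ => (1 : ℝ) / (n + 1)) atTop (𝓝 0) :=
    tendsto_one_div_add_atTop_nhds_zero_nat
  have hbdd : ∀ n, BddBelow ((fun w => E.form w w) '' S n) := by
    intro n
    refine ⟨0, ?_⟩
    rintro _ ⟨w, -, rfl⟩
    exact E.nonneg w
  have hneS : ∀ n, ∃ w ∈ S n, E.form w w ≤ M := by
    intro n
    obtain ⟨w, hwK, hw, hwM⟩ := happ (1 / (n + 1)) (by positivity)
    exact ⟨w, ⟨hwK, hw⟩, hwM⟩
  have hne : ∀ n, ((fun w => E.form w w) '' S n).Nonempty := fun n =>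
    let ⟨w, hw, _⟩ := hneS n
    ⟨_, w, hw, rfl⟩
  have hdle : ∀ n, ∀ w ∈ S n, d n ≤ E.form w w := fun n w hw =>
    csInf_le (hbdd n) ⟨w, hw, rfl⟩
  have hSmono : ∀ n m, n ≤ m → S m ⊆ S n := by
    intro n m hnm w hw
    refine ⟨hw.1, hw.2.trans ?_⟩
    gcongr
  have hdmono : Monotone d := fun n m hnm =>
    csInf_le_csInf (hbdd n) (hne m) (image_mono (hSmono n m hnm))
  have hdM : ∀ n, d n ≤ M := fun n =>
    let ⟨w, hw, hM⟩ := hneS n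
    (hdle n w hw).trans hM
  have hdconv : Tendsto d atTop (𝓝 (⨆ n, d n)) :=
    tendsto_atTop_ciSup hdmono ⟨M, by rintro _ ⟨n, rfl⟩; exact hdM n⟩
  have hdcau := hdconv.cauchySeq
  have hw : ∀ n, ∃ w ∈ S n, E.form w w < d n + 1 / (n + 1) := by
    intro n
    obtain ⟨_, ⟨w, hw, rfl⟩, hlt⟩ := exists_lt_of_csInf_lt (hne n)
      (lt_add_of_pos_right (d n) (by positivity : (0 : ℝ) < 1 / (n + 1)))
    exact ⟨w, hw, hlt⟩
  choose w hwS hwd using hw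
  have hdiff : ∀ n m, n ≤ m →
      E.form (w m - w n) (w m - w n) ≤ 2 * (d m - d n) + 4 * (1 / (n + 1)) := by
    intro n m hnm
    have hmid : (2⁻¹ : ℝ) • (w m + w n) ∈ S n := by
      refine ⟨hK _ (hwS m).1 _ (hwS n).1, ?_⟩
      have h1 := (hSmono n m hnm (hwS m)).2
      have h2 := (hwS n).2
      have h3 : (((2⁻¹ : ℝ) • (w m + w n) : E.dom) : H) - u
          = (2⁻¹ : ℝ) • (((w m : H) - u) + ((w n : H) - u)) := by
        simp only [Submodule.coe_smul, Submodule.coe_add]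
        module
      rw [h3, norm_smul, Real.norm_of_nonneg (by norm_num)]
      have h4 := norm_add_le ((w m : H) - u) ((w n : H) - u)
      linarith
    have h1 := hdle n _ hmid
    rw [form_smul_smul] at h1
    have h2 := E.form_add_add_form_sub_sub (w m) (w n)
    have h3 := hwd m
    have h4 := hwd n
    have h5 : (1 : ℝ) / (m + 1) ≤ 1 / (n + 1) := by gcongr
    linarith
  obtain ⟨v, hv⟩ := hE w (by
    have key : ∀ ε : ℝ, 0 < ε → ∃ N : ℕ, ∀ n, N ≤ n → ∀ m, n ≤ m →
        E.energyOne (w m - w n) < ε := by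
      intro ε hε
      obtain ⟨N1, hN1⟩ := Metric.cauchySeq_iff.mp hdcau (ε / 6) (by positivity)
      -- The bound 1 lets the squared distance (2/(n+1))² be replaced by 4/(n+1); the total is then
      -- below 2·ε/6 + 8·ε/24.
      obtain ⟨N2, hN2⟩ := (Metric.tendsto_atTop.mp hlim) (min (ε / 24) 1) (by positivity)
      refine ⟨max N1 N2, fun n hn m hnm => ?_⟩
      have h1 := hdiff n m hnm
      have h2 := hN1 m ((le_of_max_le_left hn).trans hnm) n (le_of_max_le_left hn)
      have h3 := hN2 n (le_of_max_le_right hn)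
      rw [Real.dist_eq] at h2
      rw [Real.dist_eq, sub_zero, abs_of_pos (by positivity), lt_min_iff] at h3
      have h4 := (hwS n).2
      have h5 := (hSmono n m hnm (hwS m)).2
      have h6 : ‖((w m - w n : E.dom) : H)‖ ≤ 2 * (1 / (n + 1)) := by
        have := norm_sub_le ((w m : H) - u) ((w n : H) - u)
        rw [sub_sub_sub_cancel_right] at this
        rw [Submodule.coe_sub]
        linarith
      have h7 : ‖((w m - w n : E.dom) : H)‖ ^ 2 ≤ 4 * (1 / (n + 1)) := by
        have := norm_nonneg ((w m - w n : E.dom) : H)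
        nlinarith
      have h8 := le_abs_self (d m - d n)
      rw [energyOne]
      linarith [h3.1]
    intro ε hε
    obtain ⟨N, hN⟩ := key ε hε
    refine ⟨N, fun m hm n hn => ?_⟩
    rcases le_total n m with h | h
    · exact hN n hn m h
    · rw [energyOne_sub_comm]
      exact hN m hm n h)
  have hvu : (v : H) = u := by
    refine tendsto_nhds_unique (tendsto_of_tendsto_energyOne hv) ?_
    rw [tendsto_iff_norm_sub_tendsto_zero]
    exact squeeze_zero (fun _ => norm_nonneg _) (fun n => (hwS n).2) hlim
  refine ⟨hvu ▸ v.2, fun ε hε => ?_⟩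
  obtain ⟨N, hN⟩ := ((tendsto_order.mp hv).2 ε hε).exists
  refine ⟨w N, (hwS N).1, ?_⟩
  have : (⟨u, hvu ▸ v.2⟩ : E.dom) = v := Subtype.ext hvu.symm
  rwa [this, energyOne_sub_comm]

end SymForm

/-! ### Truncations and piecewise linear approximation of squares on the line. -/

section Truncation

/-- The odd function that vanishes on `[-s, s]`, has slope one on `[s, t]` and is constant on
`[t, ∞)`. -/
def truncate (s t x : ℝ) : ℝ :=
  (min (max x 0) t - min (max x 0) s) - (min (max (-x) 0) t - min (max (-x) 0) s)

theorem continuous_truncate (s t : ℝ) : Continuous (truncate s t) := by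
  unfold truncate; fun_prop

variable {s t : ℝ}

theorem abs_truncate_le_abs (hs : 0 < s) (hst : s ≤ t) (x : ℝ) : |truncate s t x| ≤ |x| := by
  unfold truncate
  rcases le_total 0 x with h | h
  · rw [max_eq_left h, max_eq_right (by linarith : -x ≤ 0), abs_of_nonneg h, abs_le]
    constructor <;> rcases min_cases x t with h1 | h1 <;> rcases min_cases x s with h2 | h2 <;>
      rcases min_cases 0 t with h3 | h3 <;> rcases min_cases 0 s with h4 | h4 <;> linarith
  · rw [max_eq_right h, max_eq_left (by linarith : 0 ≤ -x), abs_of_nonpos h, abs_le]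
    constructor <;> rcases min_cases (-x) t with h1 | h1 <;>
      rcases min_cases (-x) s with h2 | h2 <;>
      rcases min_cases 0 t with h3 | h3 <;> rcases min_cases 0 s with h4 | h4 <;> linarith

theorem abs_truncate_le (hs : 0 < s) (hst : s ≤ t) (x : ℝ) : |truncate s t x| ≤ t := by
  unfold truncate
  rcases le_total 0 x with h | h
  · rw [max_eq_left h, max_eq_right (by linarith : -x ≤ 0), abs_le]
    constructor <;> rcases min_cases x t with h1 | h1 <;> rcases min_cases x s with h2 | h2 <;>
      rcases min_cases 0 t with h3 | h3 <;> rcases min_cases 0 s with h4 | h4 <;> linarith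
  · rw [max_eq_right h, max_eq_left (by linarith : 0 ≤ -x), abs_le]
    constructor <;> rcases min_cases (-x) t with h1 | h1 <;>
      rcases min_cases (-x) s with h2 | h2 <;>
      rcases min_cases 0 t with h3 | h3 <;> rcases min_cases 0 s with h4 | h4 <;> linarith

theorem abs_sub_truncate_le (hs : 0 < s) (hst : s ≤ t) {x : ℝ} (hx : |x| ≤ t) :
    |x - truncate s t x| ≤ s := by
  unfold truncate
  rcases le_total 0 x with h | h
  · rw [abs_of_nonneg h] at hx
    rw [max_eq_left h, max_eq_right (by linarith : -x ≤ 0), abs_le]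
    constructor <;> rcases min_cases x t with h1 | h1 <;> rcases min_cases x s with h2 | h2 <;>
      rcases min_cases 0 t with h3 | h3 <;> rcases min_cases 0 s with h4 | h4 <;> linarith
  · rw [abs_of_nonpos h] at hx
    rw [max_eq_right h, max_eq_left (by linarith : 0 ≤ -x), abs_le]
    constructor <;> rcases min_cases (-x) t with h1 | h1 <;>
      rcases min_cases (-x) s with h2 | h2 <;>
      rcases min_cases 0 t with h3 | h3 <;> rcases min_cases 0 s with h4 | h4 <;> linarith

theorem truncate_eq_zero (hs : 0 < s) (hst : s ≤ t) {x : ℝ} (hx : |x| ≤ s) :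
    truncate s t x = 0 := by
  have := abs_le.mp hx
  unfold truncate
  rw [min_eq_left (max_le (by linarith) (by linarith)),
    min_eq_left (max_le (by linarith) hs.le), min_eq_left (max_le (by linarith) (by linarith)),
    min_eq_left (max_le (by linarith) hs.le)]
  simp

/-- This bound makes truncations of L₂ functions integrable. -/
theorem abs_truncate_le_sq_div (hs : 0 < s) (hst : s ≤ t) (x : ℝ) :
    |truncate s t x| ≤ x ^ 2 / s := by
  rcases le_total |x| s with h | h
  · rw [truncate_eq_zero hs hst h, abs_zero]; positivity
  · refine (abs_truncate_le_abs hs hst x).trans ?_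
    rw [le_div_iff₀ hs, ← sq_abs x]
    nlinarith [abs_nonneg x]

/-- Squares are approximated by sums of shifted positive parts. -/
theorem sq_sub_sum_posPart_mem (h : ℝ) (hh : 0 < h) (n : ℕ) (y : ℝ) (hy : 0 ≤ y) :
    (y ≤ n * h → y ^ 2 - ∑ k ∈ Finset.range n, 2 * h * max (y - (k + 1) * h) 0 ∈
      Icc 0 (h * y)) ∧
    (n * h ≤ y → y ^ 2 - ∑ k ∈ Finset.range n, 2 * h * max (y - (k + 1) * h) 0 =
      (y - n * h) ^ 2 + n * h ^ 2) := by
  -- On [kh, (k+1)h] the sum has slope 2kh, so it lags y² by kh² at the node kh. The second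
  -- conjunct, valid beyond the last node, feeds the induction.
  induction n with
  | zero =>
    simp only [Nat.cast_zero, zero_mul, Finset.range_zero, Finset.sum_empty, sub_zero, add_zero,
      implies_true, and_true]
    intro h0
    rw [le_antisymm h0 hy]
    simp
  | succ n ih =>
    rw [Finset.sum_range_succ]
    push_cast
    constructor
    · intro hle
      rw [max_eq_right (by linarith), mul_zero, add_zero]
      rcases le_total y (n * h) with hc | hc
      · exact ih.1 hc
      · rw [ih.2 hc]
        constructor
        · positivity
        · nlinarith
    · intro hle
      rw [max_eq_left (by linarith)]
      have := ih.2 (by linarith)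
      linear_combination this

end Truncation

/-! ### Stability of B(E) under truncation, and approximate products. -/

section BoundedEnergy

variable {X : Type*} [MeasurableSpace X] {μ : Measure X} {E : SymForm (Lp ℝ 2 μ)}

/-- The unit contraction property, scaled to the level `c`. -/
theorem IsDirichletForm.exists_clip (hE : IsDirichletForm E) (u : E.dom) {c : ℝ} (hc : 0 < c) :
    ∃ v : E.dom, ((v : Lp ℝ 2 μ) : X → ℝ) =ᵐ[μ] (fun x => min (max ((u : Lp ℝ 2 μ) x) 0) c) ∧
      E.form v v ≤ E.form u u := by
  have hmem : MemLp (fun x => min (max (c⁻¹ * (u : Lp ℝ 2 μ) x) 0) 1) 2 μ := by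
    refine MemLp.mono ((Lp.memLp (u : Lp ℝ 2 μ)).const_mul c⁻¹) ?_ (ae_of_all _ fun x => ?_)
    · exact (((Lp.aestronglyMeasurable (u : Lp ℝ 2 μ)).const_mul c⁻¹).sup
        aestronglyMeasurable_const).inf aestronglyMeasurable_const
    · simp only [Real.norm_eq_abs]
      rw [abs_of_nonneg (le_min (le_max_right _ _) zero_le_one)]
      exact (min_le_left _ _).trans (max_le (le_abs_self _) (abs_nonneg _))
  obtain ⟨hv, hle⟩ := hE.markov (c⁻¹ • u) (hmem.toLp _) (by
    filter_upwards [hmem.coeFn_toLp, Lp.coeFn_smul c⁻¹ (u : Lp ℝ 2 μ)] with x h1 h2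
    rw [h1, Submodule.coe_smul, h2]
    rfl)
  refine ⟨c • ⟨_, hv⟩, ?_, ?_⟩
  · filter_upwards [hmem.coeFn_toLp, Lp.coeFn_smul c (hmem.toLp _)] with x h1 h2
    rw [Submodule.coe_smul, h2, Pi.smul_apply, h1, smul_eq_mul, mul_min_of_nonneg _ _ hc.le,
      mul_max_of_nonneg _ _ hc.le, mul_inv_cancel_left₀ hc.ne', mul_zero, mul_one]
  · rw [SymForm.form_smul_smul]
    rw [SymForm.form_smul_smul] at hle
    calc c ^ 2 * _ ≤ c ^ 2 * (c⁻¹ ^ 2 * E.form u u) := by gcongr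
      _ = E.form u u := by field_simp

/-- The truncation combines four clips, of u and −u at heights s and t, each with energy at most
that of u. Each of the two rounds of differences costs a factor 4, hence 16. -/
theorem IsDirichletForm.exists_truncate (hE : IsDirichletForm E) (u : E.dom) {s t : ℝ}
    (hs : 0 < s) (hst : s ≤ t) :
    ∃ v : E.dom, ((v : Lp ℝ 2 μ) : X → ℝ) =ᵐ[μ] (fun x => truncate s t ((u : Lp ℝ 2 μ) x)) ∧
      E.form v v ≤ 16 * E.form u u := by
  have ht : 0 < t := hs.trans_le hst
  obtain ⟨v1, hv1, h1⟩ := hE.exists_clip u ht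
  obtain ⟨v2, hv2, h2⟩ := hE.exists_clip u hs
  obtain ⟨v3, hv3, h3⟩ := hE.exists_clip (-u) ht
  obtain ⟨v4, hv4, h4⟩ := hE.exists_clip (-u) hs
  rw [SymForm.form_neg_neg] at h3 h4
  refine ⟨(v1 - v2) - (v3 - v4), ?_, ?_⟩
  · filter_upwards [hv1, hv2, hv3, hv4, Lp.coeFn_sub (v1 : Lp ℝ 2 μ) (v2 : Lp ℝ 2 μ),
      Lp.coeFn_sub (v3 : Lp ℝ 2 μ) (v4 : Lp ℝ 2 μ), Lp.coeFn_neg (u : Lp ℝ 2 μ),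
      
      Lp.coeFn_sub ((v1 : Lp ℝ 2 μ) - (v2 : Lp ℝ 2 μ)) ((v3 : Lp ℝ 2 μ) - (v4 : Lp ℝ 2 μ))]
      with x e1 e2 e3 e4 e5 e6 e7 e8
    simp only [Submodule.coe_sub, Submodule.coe_neg] at *
    rw [e8, Pi.sub_apply, e5, e6, Pi.sub_apply, Pi.sub_apply, e1, e2, e3, e4, e7]
    rfl
  · have h5 := E.form_sub_sub_le (v1 - v2) (v3 - v4)
    have h6 := E.form_sub_sub_le v1 v2
    have h7 := E.form_sub_sub_le v3 v4
    linarith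

theorem add_mem_boundedEnergy {f g : X → ℝ} (hf : f ∈ boundedEnergy E)
    (hg : g ∈ boundedEnergy E) : f + g ∈ boundedEnergy E := by
  obtain ⟨hf1, ⟨M, hM⟩, hf3, u, hu⟩ := hf
  obtain ⟨hg1, ⟨N, hN⟩, hg3, v, hv⟩ := hg
  exact ⟨hf1.add hg1, ⟨M + N, fun x => (abs_add_le _ _).trans (add_le_add (hM x) (hN x))⟩,
    hf3.add hg3, u + v, (Lp.coeFn_add _ _).trans (hu.add hv)⟩

theorem smul_mem_boundedEnergy (c : ℝ) {f : X → ℝ} (hf : f ∈ boundedEnergy E) :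
    c • f ∈ boundedEnergy E := by
  obtain ⟨hf1, ⟨M, hM⟩, hf3, u, hu⟩ := hf
  refine ⟨hf1.const_smul c, ⟨|c| * M, fun x => ?_⟩, hf3.smul c, c • u,
    (Lp.coeFn_smul _ _).trans (hu.const_smul c)⟩
  rw [Pi.smul_apply, smul_eq_mul, abs_mul]
  gcongr
  exact hM x

variable (E) in
/-- `B(E)` as a linear space of functions. -/
def boundedEnergySubmodule : Submodule ℝ (X → ℝ) where
  carrier := boundedEnergy E
  add_mem' := add_mem_boundedEnergy
  zero_mem' := zero_mem_boundedEnergy E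
  smul_mem' c _ := smul_mem_boundedEnergy c

theorem sub_mem_boundedEnergy {f g : X → ℝ} (hf : f ∈ boundedEnergy E)
    (hg : g ∈ boundedEnergy E) : f - g ∈ boundedEnergy E :=
  (boundedEnergySubmodule E).sub_mem hf hg

theorem neg_mem_boundedEnergy {f : X → ℝ} (hf : f ∈ boundedEnergy E) : -f ∈ boundedEnergy E :=
  (boundedEnergySubmodule E).neg_mem hf

theorem IsDirichletForm.clip_mem_boundedEnergy (hE : IsDirichletForm E) {f : X → ℝ}
    (hf : f ∈ boundedEnergy E) {c : ℝ} (hc : 0 < c) :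
    (fun x => min (max (f x) 0) c) ∈ boundedEnergy E := by
  obtain ⟨hf1, ⟨M, hM⟩, hf3, u, hu⟩ := hf
  have hle : ∀ x, |min (max (f x) 0) c| ≤ |f x| := fun x => by
    rw [abs_of_nonneg (le_min (le_max_right _ _) hc.le)]
    exact (min_le_left _ _).trans (max_le (le_abs_self _) (abs_nonneg _))
  have hmeas : Measurable fun x => min (max (f x) 0) c := by fun_prop
  obtain ⟨v, hv, -⟩ := hE.exists_clip u hc
  refine ⟨hmeas, ⟨M, fun x => (hle x).trans (hM x)⟩,
    hf3.mono hmeas.aestronglyMeasurable (ae_of_all _ hle), v, hv.trans ?_⟩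
  filter_upwards [hu] with x hx
  rw [hx]

theorem IsDirichletForm.posPart_mem_boundedEnergy (hE : IsDirichletForm E) {f : X → ℝ}
    (hf : f ∈ boundedEnergy E) : (fun x => max (f x) 0) ∈ boundedEnergy E := by
  obtain ⟨M, hM⟩ := hf.2.1
  -- The level is positive and exceeds the bound of f, so the clip cuts nothing from above.
  have h := hE.clip_mem_boundedEnergy hf (c := |M| + 1) (by positivity)
  have heq : (fun x => min (max (f x) 0) (|M| + 1)) = fun x => max (f x) 0 := by
    funext x
    refine min_eq_left (max_le ?_ (by positivity))
    linarith [le_abs_self (f x), hM x, le_abs_self M]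
  rwa [heq] at h

theorem IsDirichletForm.posPart_sub_mem_boundedEnergy (hE : IsDirichletForm E) {f : X → ℝ}
    (hf : f ∈ boundedEnergy E) {s : ℝ} (hs : 0 < s) :
    (fun x => max (f x - s) 0) ∈ boundedEnergy E := by
  have h := sub_mem_boundedEnergy (hE.posPart_mem_boundedEnergy hf)
    (hE.clip_mem_boundedEnergy hf hs)
  have heq : ((fun x => max (f x) 0) - fun x => min (max (f x) 0) s) =
      fun x => max (f x - s) 0 := by
    funext x
    simp only [Pi.sub_apply]
    rcases max_cases (f x) 0 with h1 | h1 <;> rcases max_cases (f x - s) 0 with h2 | h2 <;>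
      rcases min_cases (max (f x) 0) s with h3 | h3 <;> linarith
  rwa [heq] at h

theorem IsDirichletForm.truncate_mem_boundedEnergy (hE : IsDirichletForm E) {f : X → ℝ}
    (hf : f ∈ boundedEnergy E) {s t : ℝ} (hs : 0 < s) (hst : s ≤ t) :
    (fun x => truncate s t (f x)) ∈ boundedEnergy E := by
  have ht : 0 < t := hs.trans_le hst
  have hn := neg_mem_boundedEnergy hf
  exact sub_mem_boundedEnergy
    (sub_mem_boundedEnergy (hE.clip_mem_boundedEnergy hf ht) (hE.clip_mem_boundedEnergy hf hs))
    (sub_mem_boundedEnergy (hE.clip_mem_boundedEnergy hn ht) (hE.clip_mem_boundedEnergy hn hs))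

/-- A measurable representative of an element of the domain, truncated, belongs to `B(E)`. -/
theorem IsDirichletForm.truncate_dom_mem_boundedEnergy (hE : IsDirichletForm E) (u : E.dom)
    {f : X → ℝ} (hf : Measurable f) (hu : ((u : Lp ℝ 2 μ) : X → ℝ) =ᵐ[μ] f) {s t : ℝ}
    (hs : 0 < s) (hst : s ≤ t) : (fun x => truncate s t (f x)) ∈ boundedEnergy E := by
  obtain ⟨v, hv, -⟩ := hE.exists_truncate u hs hst
  have hmeas : Measurable fun x => truncate s t (f x) :=
    (continuous_truncate s t).measurable.comp hf
  refine ⟨hmeas, ⟨t, fun x => abs_truncate_le hs hst _⟩, ?_, v, hv.trans ?_⟩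
  · have hint : Integrable (fun x => f x ^ 2) μ :=
      ((memLp_congr_ae hu).mp (Lp.memLp (u : Lp ℝ 2 μ))).integrable_sq
    exact (hint.div_const s).mono' hmeas.aestronglyMeasurable
      (ae_of_all _ fun x => abs_truncate_le_sq_div hs hst _)
  · filter_upwards [hu] with x hx
    rw [hx]

/-- The piecewise linear approximation of y² is applied to f, with mesh h = ε / K for an upper bound
K of f; the error h f is then at most ε. -/
theorem IsDirichletForm.exists_near_sq_of_nonneg (hE : IsDirichletForm E) {f : X → ℝ}
    (hf : f ∈ boundedEnergy E) (hf0 : ∀ x, 0 ≤ f x) {ε : ℝ} (hε : 0 < ε) :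
    ∃ g ∈ boundedEnergy E, ∀ x, |f x ^ 2 - g x| ≤ ε := by
  obtain ⟨M, hM⟩ := hf.2.1
  set K : ℝ := |M| + 1 with hK
  have hK0 : 0 < K := by positivity
  have hfK : ∀ x, f x ≤ K := fun x => by
    linarith [le_abs_self (f x), hM x, le_abs_self M]
  set h : ℝ := ε / K with hh
  have hh0 : 0 < h := by positivity
  obtain ⟨n, hn⟩ := exists_nat_ge (K / h)
  rw [div_le_iff₀ hh0] at hn
  refine ⟨∑ k ∈ Finset.range n, (2 * h) • fun x => max (f x - (k + 1) * h) 0,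
    (boundedEnergySubmodule E).sum_mem fun k _ => smul_mem_boundedEnergy _
      (hE.posPart_sub_mem_boundedEnergy hf (by positivity)), fun x => ?_⟩
  have h1 := (sq_sub_sum_posPart_mem h hh0 n (f x) (hf0 x)).1 ((hfK x).trans hn)
  simp only [Finset.sum_apply, Pi.smul_apply, smul_eq_mul]
  rw [abs_of_nonneg h1.1]
  calc _ ≤ h * f x := h1.2
    _ ≤ h * K := by gcongr; exact hfK x
    _ = ε := by rw [hh]; field_simp

theorem IsDirichletForm.exists_near_sq (hE : IsDirichletForm E) {f : X → ℝ}
    (hf : f ∈ boundedEnergy E) {ε : ℝ} (hε : 0 < ε) :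
    ∃ g ∈ boundedEnergy E, ∀ x, |f x ^ 2 - g x| ≤ ε := by
  obtain ⟨g1, hg1, h1⟩ := hE.exists_near_sq_of_nonneg (hE.posPart_mem_boundedEnergy hf)
    (fun x => le_max_right _ _) (half_pos hε)
  obtain ⟨g2, hg2, h2⟩ := hE.exists_near_sq_of_nonneg
    (hE.posPart_mem_boundedEnergy (neg_mem_boundedEnergy hf))
    (fun x => le_max_right _ _) (half_pos hε)
  refine ⟨g1 + g2, add_mem_boundedEnergy hg1 hg2, fun x => ?_⟩
  have h3 : f x ^ 2 = max (f x) 0 ^ 2 + max ((-f) x) 0 ^ 2 := by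
    rw [Pi.neg_apply]
    rcases le_total 0 (f x) with h | h
    · rw [max_eq_left h, max_eq_right (by linarith)]; ring
    · rw [max_eq_right h, max_eq_left (by linarith)]; ring
  have h4 := abs_le.mp (h1 x)
  have h5 := abs_le.mp (h2 x)
  rw [h3, Pi.add_apply, abs_le]
  constructor <;> linarith

/-- Products of functions in `B(E)` are uniform limits of functions in `B(E)`. -/
theorem IsDirichletForm.exists_near_mul (hE : IsDirichletForm E) {f g : X → ℝ}
    (hf : f ∈ boundedEnergy E) (hg : g ∈ boundedEnergy E) {ε : ℝ} (hε : 0 < ε) :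
    ∃ k ∈ boundedEnergy E, ∀ x, |f x * g x - k x| ≤ ε := by
  obtain ⟨k1, hk1, h1⟩ := hE.exists_near_sq (add_mem_boundedEnergy hf hg) hε
  obtain ⟨k2, hk2, h2⟩ := hE.exists_near_sq (sub_mem_boundedEnergy hf hg) hε
  refine ⟨(4⁻¹ : ℝ) • (k1 - k2), smul_mem_boundedEnergy _ (sub_mem_boundedEnergy hk1 hk2),
    fun x => ?_⟩
  have h4 := abs_le.mp (h1 x)
  have h5 := abs_le.mp (h2 x)
  simp only [Pi.add_apply, Pi.sub_apply, Pi.smul_apply, smul_eq_mul] at *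
  rw [abs_le]
  constructor <;> nlinarith

theorem norm_sq_eq_integral_sq (f : Lp ℝ 2 μ) : ‖f‖ ^ 2 = ∫ x, f x ^ 2 ∂μ := by
  rw [← real_inner_self_eq_norm_sq, L2.inner_def]
  simp [sq]

/-- Elements of the domain are approximated in `L₂`, with bounded energies, by truncations. -/
theorem IsDirichletForm.exists_truncate_truncate_near (hE : IsDirichletForm E) (u : E.dom)
    {f : X → ℝ} (hu : ((u : Lp ℝ 2 μ) : X → ℝ) =ᵐ[μ] f) {δ : ℝ}
    (hδ : 0 < δ) : ∃ s t : ℝ, 0 < s ∧ s ≤ t ∧ ∃ w : E.dom,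
      ((w : Lp ℝ 2 μ) : X → ℝ) =ᵐ[μ] (fun x => truncate s t (truncate s t (f x))) ∧
      ‖(w : Lp ℝ 2 μ) - u‖ ≤ δ ∧ E.form w w ≤ 256 * E.form u u := by
  -- The levels satisfy s → 0 and t → ∞. Two truncations serve two purposes: the first yields a
  -- bounded integrable function, hence one in B(E), and the second gives it a compactly supported
  -- transform. The factor 256 is 16².
  set s : ℕ → ℝ := fun n => 1 / (n + 1) with hs
  set t : ℕ → ℝ := fun n => n + 1 with ht
  have hs0 : ∀ n, 0 < s n := fun n => by positivity
  have hst : ∀ n, s n ≤ t n := fun n => by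
    have : (1 : ℝ) ≤ n + 1 := by linarith [n.cast_nonneg (α := ℝ)]
    simp only [hs, ht]
    rw [div_le_iff₀ (by positivity)]
    nlinarith
  choose v hv hvE using fun n => hE.exists_truncate u (hs0 n) (hst n)
  choose w hw hwE using fun n => hE.exists_truncate (v n) (hs0 n) (hst n)
  have hwf : ∀ n, ((w n : Lp ℝ 2 μ) : X → ℝ) =ᵐ[μ]
      (fun x => truncate (s n) (t n) (truncate (s n) (t n) (f x))) := fun n => by
    filter_upwards [hw n, hv n, hu] with x h1 h2 h3
    rw [h1, h2, h3]
  have hlim : Tendsto (fun n => ((w n : Lp ℝ 2 μ))) atTop (𝓝 (u : Lp ℝ 2 μ)) := by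
    have hL2 : ∀ n, ‖(w n : Lp ℝ 2 μ) - u‖ ^ 2 =
        ∫ x, (truncate (s n) (t n) (truncate (s n) (t n) (f x)) - f x) ^ 2 ∂μ := fun n => by
      rw [norm_sq_eq_integral_sq]
      refine integral_congr_ae ?_
      filter_upwards [hwf n, hu, Lp.coeFn_sub (w n : Lp ℝ 2 μ) (u : Lp ℝ 2 μ)] with x h1 h2 h3
      rw [h3, Pi.sub_apply, h1, h2]
    have hf2 : MemLp f 2 μ := (memLp_congr_ae hu).mp (Lp.memLp (u : Lp ℝ 2 μ))
    have hint : Tendsto (fun n => ‖(w n : Lp ℝ 2 μ) - u‖ ^ 2) atTop (𝓝 0) := by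
      simp_rw [hL2]
      rw [← integral_zero X ℝ (μ := μ)]
      refine tendsto_integral_of_dominated_convergence (fun x => 4 * f x ^ 2) (fun n => ?_)
        (hf2.integrable_sq.const_mul 4) (fun n => ae_of_all _ fun x => ?_) (ae_of_all _ fun x => ?_)
      · have hc := continuous_truncate (s n) (t n)
        exact (((hc.comp hc).comp_aestronglyMeasurable hf2.1).sub hf2.1).pow 2
      · have h1 := abs_truncate_le_abs (hs0 n) (hst n) (f x)
        have h2 := abs_truncate_le_abs (hs0 n) (hst n) (truncate (s n) (t n) (f x))
        have h3 := abs_sub (truncate (s n) (t n) (truncate (s n) (t n) (f x))) (f x)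
        rw [Real.norm_eq_abs, abs_of_nonneg (sq_nonneg _), ← sq_abs, ← sq_abs (f x)]
        have h4 := abs_nonneg (truncate (s n) (t n) (truncate (s n) (t n) (f x)) - f x)
        nlinarith
      · have h0 : Tendsto (fun n => (2 * s n) ^ 2) atTop (𝓝 0) := by
          have := (tendsto_one_div_add_atTop_nhds_zero_nat (𝕜 := ℝ)).const_mul 2
          simpa [hs] using this.pow 2
        refine squeeze_zero' (Eventually.of_forall fun n => sq_nonneg _) ?_ h0
        obtain ⟨N, hN⟩ := exists_nat_ge |f x|
        filter_upwards [eventually_ge_atTop N] with n hn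
        have hft : |f x| ≤ t n := by
          have : (N : ℝ) ≤ n := by exact_mod_cast hn
          simp only [ht]; linarith
        have h1 := abs_sub_truncate_le (hs0 n) (hst n) hft
        have h2 := abs_sub_truncate_le (hs0 n) (hst n)
          ((abs_truncate_le_abs (hs0 n) (hst n) (f x)).trans hft)
        rw [sq_le_sq, abs_of_pos (by linarith [hs0 n] : 0 < 2 * s n), abs_le]
        rw [abs_le] at h1 h2
        constructor <;> linarith
    rw [tendsto_iff_norm_sub_tendsto_zero]
    have h2 := (Real.continuous_sqrt.tendsto 0).comp hint
    simpa [Function.comp_def, Real.sqrt_sq (norm_nonneg _)] using h2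
  obtain ⟨n, hn⟩ := ((Metric.tendsto_atTop.mp hlim) δ hδ)
  refine ⟨s n, t n, hs0 n, hst n, w n, hwf n, ?_, ?_⟩
  · rw [← dist_eq_norm]
    exact (hn n le_rfl).le
  · linarith [hvE n, hwE n]

end BoundedEnergy

/-! ### The uniform algebra A and the map from X to its spectrum. -/

section UniformAlgebra

variable {X : Type*} [MeasurableSpace X] {μ : Measure X} {E : SymForm (Lp ℝ 2 μ)}

set_option synthInstance.maxHeartbeats 200000 in
instance (E : SymForm (Lp ℝ 2 μ)) : NonUnitalNormedRing (uniformAlgebra E) := inferInstance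

set_option synthInstance.maxHeartbeats 200000 in
instance (E : SymForm (Lp ℝ 2 μ)) : NormedSpace ℂ (uniformAlgebra E) := inferInstance

set_option synthInstance.maxHeartbeats 200000 in
instance (E : SymForm (Lp ℝ 2 μ)) : Module ℂ (uniformAlgebra E) := inferInstance

set_option synthInstance.maxHeartbeats 200000 in
instance (E : SymForm (Lp ℝ 2 μ)) : SMul ℂ (uniformAlgebra E) := inferInstance

set_option synthInstance.maxHeartbeats 200000 in
instance (E : SymForm (Lp ℝ 2 μ)) : DistribMulAction ℂ (uniformAlgebra E) := inferInstance

set_option synthInstance.maxHeartbeats 200000 in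
instance (E : SymForm (Lp ℝ 2 μ)) : AddCommGroup (uniformAlgebra E) := inferInstance

set_option synthInstance.maxHeartbeats 200000 in
instance (E : SymForm (Lp ℝ 2 μ)) : StarRing (uniformAlgebra E) := inferInstance

theorem IsDirichletForm.mul_mem_closure_complexification (hE : IsDirichletForm E)
    {a b : lp (fun _ : X => ℂ) ∞} (ha : a ∈ complexification E) (hb : b ∈ complexification E) :
    a * b ∈ closure (complexification E) := by
  obtain ⟨f, hf, g, hg, hfg⟩ := ha
  obtain ⟨f', hf', g', hg', hfg'⟩ := hb
  rw [Metric.mem_closure_iff]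
  intro ε hε
  have hε' : 0 < ε / 5 := by positivity
  obtain ⟨k1, hk1, h1⟩ := hE.exists_near_mul hf hf' hε'
  obtain ⟨k2, hk2, h2⟩ := hE.exists_near_mul hg hg' hε'
  obtain ⟨k3, hk3, h3⟩ := hE.exists_near_mul hf hg' hε'
  obtain ⟨k4, hk4, h4⟩ := hE.exists_near_mul hg hf' hε'
  have hre := sub_mem_boundedEnergy hk1 hk2
  have him := add_mem_boundedEnergy hk3 hk4
  have hmem : Memℓp (fun x => ((k1 - k2) x : ℂ) + Complex.I * ((k3 + k4) x : ℂ)) ∞ :=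
    (memlp_of_mem E ⟨_, hre⟩).add ((memlp_of_mem E ⟨_, him⟩).const_mul Complex.I)
  refine ⟨⟨_, hmem⟩, ⟨_, hre, _, him, fun x => rfl⟩, ?_⟩
  rw [dist_eq_norm]
  refine lt_of_le_of_lt (lp.norm_le_of_forall_le (C := 4 * (ε / 5)) (by positivity) fun x => ?_)
    (by linarith)
  have hval : (a * b - ⟨_, hmem⟩ : lp (fun _ : X => ℂ) ∞) x =
      ((f x * f' x - k1 x : ℝ) : ℂ) - ((g x * g' x - k2 x : ℝ) : ℂ) +
      Complex.I * (((f x * g' x - k3 x : ℝ) : ℂ) + ((g x * f' x - k4 x : ℝ) : ℂ)) := by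
    have : (a * b - ⟨_, hmem⟩ : lp (fun _ : X => ℂ) ∞) x =
        a x * b x - (((k1 - k2) x : ℂ) + Complex.I * ((k3 + k4) x : ℂ)) := rfl
    rw [this, hfg, hfg']
    simp only [Pi.sub_apply, Pi.add_apply]
    push_cast
    linear_combination (g x * g' x : ℂ) * Complex.I_sq
  rw [hval]
  refine (norm_add_le _ _).trans ?_
  rw [norm_mul, Complex.norm_I, one_mul]
  have e1 := norm_sub_le ((f x * f' x - k1 x : ℝ) : ℂ) ((g x * g' x - k2 x : ℝ) : ℂ)
  have e2 := norm_add_le ((f x * g' x - k3 x : ℝ) : ℂ) ((g x * f' x - k4 x : ℝ) : ℂ)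
  rw [Complex.norm_real, Complex.norm_real, Real.norm_eq_abs, Real.norm_eq_abs] at e1 e2
  linarith [h1 x, h2 x, h3 x, h4 x]

/-- The uniform closure of `B(E) + i B(E)` as a *-algebra. -/
def IsDirichletForm.closureAlgebra (hE : IsDirichletForm E) :
    NonUnitalStarSubalgebra ℂ (lp (fun _ : X => ℂ) ∞) where
  carrier := closure (complexification E)
  add_mem' {a b} ha hb := map_mem_closure₂ continuous_add ha hb (by
    rintro a ⟨f, hf, g, hg, h⟩ b ⟨f', hf', g', hg', h'⟩
    refine ⟨_, add_mem_boundedEnergy hf hf', _, add_mem_boundedEnergy hg hg', fun x => ?_⟩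
    rw [lp.coeFn_add, Pi.add_apply, h, h', Pi.add_apply, Pi.add_apply]
    push_cast
    ring)
  zero_mem' := subset_closure ⟨_, zero_mem_boundedEnergy E, _, zero_mem_boundedEnergy E,
    fun x => by simp⟩
  mul_mem' {a b} ha hb := isClosed_closure.closure_eq.subset
    (map_mem_closure₂ continuous_mul ha hb fun _ ha _ hb =>
      hE.mul_mem_closure_complexification ha hb)
  smul_mem' c a ha := map_mem_closure (continuous_const_smul c) ha (by
    rintro a ⟨f, hf, g, hg, h⟩
    refine ⟨_, sub_mem_boundedEnergy (smul_mem_boundedEnergy c.re hf)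
      (smul_mem_boundedEnergy c.im hg), _, add_mem_boundedEnergy (smul_mem_boundedEnergy c.re hg)
      (smul_mem_boundedEnergy c.im hf), fun x => ?_⟩
    rw [lp.coeFn_smul, Pi.smul_apply, h, smul_eq_mul]
    simp only [Pi.sub_apply, Pi.add_apply, Pi.smul_apply, smul_eq_mul]
    nth_rewrite 1 [← Complex.re_add_im c]
    push_cast
    linear_combination (c.im * g x : ℂ) * Complex.I_sq)
  star_mem' {a} ha := map_mem_closure continuous_star ha (by
    rintro a ⟨f, hf, g, hg, h⟩
    refine ⟨f, hf, _, neg_mem_boundedEnergy hg, fun x => ?_⟩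
    rw [lp.coeFn_star, Pi.star_apply, h]
    simp)

/-- The uniform closure of B(E) + iB(E) is already a *-algebra, so generating one adds nothing. -/
theorem IsDirichletForm.coe_uniformAlgebra (hE : IsDirichletForm E) :
    (uniformAlgebra E : Set (lp (fun _ : X => ℂ) ∞)) = closure (complexification E) := by
  refine subset_antisymm ?_ (closure_mono (NonUnitalStarAlgebra.subset_adjoin ℂ _))
  have h : NonUnitalStarAlgebra.adjoin ℂ (complexification E) ≤ hE.closureAlgebra :=
    NonUnitalStarAlgebra.adjoin_le subset_closure
  exact closure_minimal h isClosed_closure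

instance (E : SymForm (Lp ℝ 2 μ)) : CompleteSpace (uniformAlgebra E) :=
  (NonUnitalStarSubalgebra.isClosed_topologicalClosure _).completeSpace_coe

/-- The algebra `A(B(E))` as an algebra of functions on `X`. -/
def pointwiseRepresentation (E : SymForm (Lp ℝ 2 μ)) :
    FunctionRepresentation X (uniformAlgebra E) where
  eval :=
    { toFun := fun a => (a : lp (fun _ : X => ℂ) ∞)
      map_smul' := fun c a => rfl
      map_zero' := rfl
      map_add' := fun a b => rfl
      map_mul' := fun a b => rfl
      map_star' := fun a => rfl }
  norm_eval_le a x := lp.norm_apply_le_norm (by simp) (a : lp (fun _ : X => ℂ) ∞) x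
  norm_le a c hc h := lp.norm_le_of_forall_le hc h

theorem IsDirichletForm.exists_norm_sub_le (hE : IsDirichletForm E) (a : uniformAlgebra E) {ε : ℝ}
    (hε : 0 < ε) : ∃ f g : boundedEnergy E,
      ‖a - (toAlgebra E f + Complex.I • toAlgebra E g)‖ < ε := by
  have ha : (a : lp (fun _ : X => ℂ) ∞) ∈ closure (complexification E) := by
    rw [← hE.coe_uniformAlgebra]; exact a.2
  obtain ⟨b, ⟨f, hf, g, hg, h⟩, hd⟩ := Metric.mem_closure_iff.mp ha ε hε
  refine ⟨⟨f, hf⟩, ⟨g, hg⟩, ?_⟩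
  rw [dist_eq_norm] at hd
  refine lt_of_eq_of_lt ?_ hd
  change ‖(a : lp (fun _ : X => ℂ) ∞) - _‖ = _
  congr 2
  ext x
  rw [h]
  rfl

/-- Real parts of elements of `A(B(E))` are uniform limits of functions in `B(E)`. -/
theorem IsDirichletForm.exists_abs_re_sub_le (hE : IsDirichletForm E) (a : uniformAlgebra E)
    {ε : ℝ} (hε : 0 < ε) : ∃ f ∈ boundedEnergy E,
      ∀ x, |((a : lp (fun _ : X => ℂ) ∞) x).re - f x| ≤ ε := by
  obtain ⟨f, g, h⟩ := hE.exists_norm_sub_le a hε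
  refine ⟨f, f.2, fun x => ?_⟩
  have h1 := ((pointwiseRepresentation E).norm_eval_le
    (a - (toAlgebra E f + Complex.I • toAlgebra E g)) x).trans h.le
  refine le_trans ?_ ((Complex.abs_re_le_norm _).trans h1)
  refine le_of_eq (congrArg abs ?_)
  change _ = ((a : lp (fun _ : X => ℂ) ∞) x -
    (((f : X → ℝ) x : ℂ) + Complex.I * ((g : X → ℝ) x : ℂ))).re
  simp

theorem IsDirichletForm.separableSpace_uniformAlgebra (hE : IsDirichletForm E)
    (hsep : SupSeparable (boundedEnergy E)) :
    TopologicalSpace.SeparableSpace (uniformAlgebra E) := by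
  obtain ⟨D, hD, hDB, hdense⟩ := hsep
  have : Countable D := hD.to_subtype
  set F : D × D → uniformAlgebra E := fun p =>
    toAlgebra E ⟨p.1, hDB p.1.2⟩ + Complex.I • toAlgebra E ⟨p.2, hDB p.2.2⟩ with hF
  refine ⟨⟨range F, countable_range F, fun a => ?_⟩⟩
  rw [Metric.mem_closure_iff]
  intro ε hε
  obtain ⟨f, g, h⟩ := hE.exists_norm_sub_le a (half_pos hε)
  obtain ⟨f', hf', hff'⟩ := hdense f f.2 (ε / 4) (by positivity)
  obtain ⟨g', hg', hgg'⟩ := hdense g g.2 (ε / 4) (by positivity)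
  refine ⟨_, ⟨(⟨f', hf'⟩, ⟨g', hg'⟩), rfl⟩, ?_⟩
  have h2 : ‖(toAlgebra E f + Complex.I • toAlgebra E g) - F (⟨f', hf'⟩, ⟨g', hg'⟩)‖ ≤ ε / 2 := by
    refine (pointwiseRepresentation E).norm_le _ _ (by positivity) fun x => ?_
    have hval : (pointwiseRepresentation E).eval
        ((toAlgebra E f + Complex.I • toAlgebra E g) - F (⟨f', hf'⟩, ⟨g', hg'⟩)) x =
        ((f : X → ℝ) x - f' x : ℝ) + Complex.I * ((g : X → ℝ) x - g' x : ℝ) := by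
      change (((f : X → ℝ) x : ℂ) + Complex.I * ((g : X → ℝ) x : ℂ)) -
        ((f' x : ℂ) + Complex.I * (g' x : ℂ)) = _
      push_cast
      ring
    rw [hval]
    refine (norm_add_le _ _).trans ?_
    rw [norm_mul, Complex.norm_I, one_mul, Complex.norm_real, Complex.norm_real,
      Real.norm_eq_abs, Real.norm_eq_abs]
    linarith [hff' x, hgg' x]
  rw [dist_eq_norm]
  have h3 := norm_add_le (a - (toAlgebra E f + Complex.I • toAlgebra E g))
    ((toAlgebra E f + Complex.I • toAlgebra E g) - F (⟨f', hf'⟩, ⟨g', hg'⟩))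
  rw [sub_add_sub_cancel] at h3
  linarith

theorem exists_eval_ne_zero (hvan : VanishesNowhere (boundedEnergy E)) (x : X) :
    ∃ a : uniformAlgebra E, (pointwiseRepresentation E).eval a x ≠ 0 := by
  obtain ⟨f, hf, hfx⟩ := hvan x
  refine ⟨toAlgebra E ⟨f, hf⟩, ?_⟩
  change ((f x : ℝ) : ℂ) ≠ 0
  exact_mod_cast hfx

/-- The canonical map from `X` to the spectrum. -/
def toSpectrum (hvan : VanishesNowhere (boundedEnergy E)) : X → Spectrum E :=
  (pointwiseRepresentation E).pointCharacter (exists_eval_ne_zero hvan)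

theorem hat_toSpectrum (hvan : VanishesNowhere (boundedEnergy E)) (f : boundedEnergy E) (x : X) :
    hat E f (toSpectrum hvan x) = (f : X → ℝ) x := rfl

theorem denseRange_toSpectrum (hvan : VanishesNowhere (boundedEnergy E)) :
    DenseRange (toSpectrum hvan) :=
  (pointwiseRepresentation E).denseRange_pointCharacter _

theorem continuous_gelfand (a : uniformAlgebra E) : Continuous (gelfand E a) :=
  continuous_character_apply a

theorem continuous_hat (f : boundedEnergy E) : Continuous (hat E f) :=
  Complex.continuous_re.comp (continuous_gelfand _)

/-- Two continuous functions on the spectrum coincide if they coincide on `X`. -/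
theorem eq_of_comp_toSpectrum_eq (hvan : VanishesNowhere (boundedEnergy E)) {Y : Type*}
    [TopologicalSpace Y] [T2Space Y] {g h : Spectrum E → Y} (hg : Continuous g)
    (hh : Continuous h) (heq : ∀ x, g (toSpectrum hvan x) = h (toSpectrum hvan x)) : g = h :=
  (denseRange_toSpectrum hvan).equalizer hg hh (funext heq)

/-- Both sides are continuous and agree on the dense image of X, so the transform of a real function
is real. -/
theorem gelfand_toAlgebra (hvan : VanishesNowhere (boundedEnergy E)) (f : boundedEnergy E)
    (φ : Spectrum E) : gelfand E (toAlgebra E f) φ = (hat E f φ : ℂ) :=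
  congrFun (eq_of_comp_toSpectrum_eq hvan (continuous_gelfand _)
    (Complex.continuous_ofReal.comp (continuous_hat f)) fun _ => rfl) φ

theorem isCompact_le_abs_hat (hvan : VanishesNowhere (boundedEnergy E)) (f : boundedEnergy E)
    {ε : ℝ} (hε : 0 < ε) : IsCompact {φ : Spectrum E | ε ≤ |hat E f φ|} := by
  have h := (pointwiseRepresentation E).isCompact_le_norm_character_apply (toAlgebra E f) hε
  have heq : {φ : Spectrum E | ε ≤ |hat E f φ|} = {φ : Spectrum E | ε ≤ ‖φ (toAlgebra E f)‖} := by
    ext φ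
    have : φ (toAlgebra E f) = (hat E f φ : ℂ) := gelfand_toAlgebra hvan f φ
    rw [mem_ofPred_eq, mem_ofPred_eq, this, Complex.norm_real, Real.norm_eq_abs]
  rw [heq]
  exact h

theorem IsDirichletForm.hat_truncate (hE : IsDirichletForm E)
    (hvan : VanishesNowhere (boundedEnergy E)) (f : boundedEnergy E) {s t : ℝ} (hs : 0 < s)
    (hst : s ≤ t) : hat E ⟨_, hE.truncate_mem_boundedEnergy f.2 hs hst⟩ =
      fun φ => truncate s t (hat E f φ) :=
  eq_of_comp_toSpectrum_eq hvan (continuous_hat _)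
    ((continuous_truncate s t).comp (continuous_hat f)) fun _ => rfl

/-- Truncation produces functions whose Gelfand transform has compact support. -/
theorem IsDirichletForm.hasCompactSupport_hat_truncate (hE : IsDirichletForm E)
    (hvan : VanishesNowhere (boundedEnergy E)) (f : boundedEnergy E) {s t : ℝ} (hs : 0 < s)
    (hst : s ≤ t) :
    HasCompactSupport (hat E ⟨_, hE.truncate_mem_boundedEnergy f.2 hs hst⟩) := by
  refine HasCompactSupport.intro (isCompact_le_abs_hat hvan f hs) fun φ hφ => ?_
  rw [hE.hat_truncate hvan f hs hst]
  rw [mem_ofPred_eq, not_le] at hφ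
  exact truncate_eq_zero hs hst hφ.le

end UniformAlgebra

/-! ### The image measure: measurability, regularity, representation and uniqueness. -/

section TransferredMeasure

variable {X : Type*} [MeasurableSpace X] {μ : Measure X} {E : SymForm (Lp ℝ 2 μ)}

theorem IsDirichletForm.measurable_coe (hE : IsDirichletForm E) (a : uniformAlgebra E) :
    Measurable fun x => (a : lp (fun _ : X => ℂ) ∞) x := by
  choose f g h using fun n : ℕ =>
    hE.exists_norm_sub_le a (Nat.one_div_pos_of_nat (α := ℝ) (n := n))
  refine measurable_of_tendsto_metrizable
    (f := fun (n : ℕ) (x : X) => ((f n : X → ℝ) x : ℂ) + Complex.I * ((g n : X → ℝ) x : ℂ))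
    (fun n => ?_) (tendsto_pi_nhds.mpr fun x => ?_)
  · exact (Complex.measurable_ofReal.comp (f n).2.1).add
      ((Complex.measurable_ofReal.comp (g n).2.1).const_mul _)
  · rw [tendsto_iff_norm_sub_tendsto_zero]
    refine squeeze_zero (fun _ => norm_nonneg _) (fun n => ?_)
      (tendsto_one_div_add_atTop_nhds_zero_nat (𝕜 := ℝ))
    rw [norm_sub_rev]
    exact ((pointwiseRepresentation E).norm_eval_le
      (a - (toAlgebra E (f n) + Complex.I • toAlgebra E (g n))) x).trans (h n).le

theorem IsDirichletForm.secondCountableTopology_spectrum (hE : IsDirichletForm E)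
    (hsep : SupSeparable (boundedEnergy E)) : SecondCountableTopology (Spectrum E) :=
  have := hE.separableSpace_uniformAlgebra hsep
  (pointwiseRepresentation E).secondCountableTopology_characterSpace

variable (E) in
theorem locallyCompactSpace_spectrum : LocallyCompactSpace (Spectrum E) :=
  (pointwiseRepresentation E).locallyCompactSpace_characterSpace

variable (E) in
theorem t2Space_spectrum : T2Space (Spectrum E) :=
  inferInstanceAs (T2Space (WeakDual.characterSpace ℂ (uniformAlgebra E)))

/-- Preimages of open sets under Gelfand transforms form a subbasis of Δ. By second countability
they generate the Borel σ-algebra, and their preimages in X are measurable because elements of A are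
measurable functions. -/
theorem IsDirichletForm.measurable_toSpectrum (hE : IsDirichletForm E)
    (hvan : VanishesNowhere (boundedEnergy E)) (hsep : SupSeparable (boundedEnergy E)) :
    Measurable (toSpectrum hvan) := by
  have := hE.secondCountableTopology_spectrum hsep
  have htop : (inferInstance : TopologicalSpace (Spectrum E)) = TopologicalSpace.generateFrom
      (⋃ a : uniformAlgebra E,
        {s | IsOpen[TopologicalSpace.induced (gelfand E a) inferInstance] s}) := by
    rw [generateFrom_iUnion]
    simp_rw [TopologicalSpace.generateFrom_setOfPred_isOpen]
    refine (isInducing_character_apply (A := uniformAlgebra E)).eq_induced.trans ?_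
    rw [Pi.topologicalSpace, induced_iInf]
    refine iInf_congr fun a => ?_
    rw [induced_compose]
    rfl
  refine measurable_of_isOpen fun U hU => ?_
  have hU' : MeasurableSet[MeasurableSpace.generateFrom
      (⋃ a : uniformAlgebra E,
        {s | IsOpen[TopologicalSpace.induced (gelfand E a) inferInstance] s})]
      U := by
    rw [← borel_eq_generateFrom_of_subbasis htop]
    exact MeasurableSpace.measurableSet_generateFrom hU
  refine measurable_generateFrom (fun s hs => ?_) hU'
  obtain ⟨a, V, hV, rfl⟩ := mem_iUnion.mp hs
  exact hE.measurable_coe a hV.measurableSet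

/-- A character that kills B(E) kills its complex span, which is dense in A, and so vanishes. -/
theorem IsDirichletForm.exists_hat_ne_zero (hE : IsDirichletForm E)
    (hvan : VanishesNowhere (boundedEnergy E)) (φ : Spectrum E) :
    ∃ f : boundedEnergy E, hat E f φ ≠ 0 := by
  by_contra! hcon
  refine φ.2.1 (ContinuousLinearMap.ext fun a => ?_)
  change gelfand E a φ = 0
  rw [← norm_le_zero_iff]
  refine le_of_forall_pos_le_add fun ε hε => ?_
  obtain ⟨f, g, h⟩ := hE.exists_norm_sub_le a hε
  have h0 : ∀ f, φ (toAlgebra E f) = 0 := fun f => by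
    have := gelfand_toAlgebra hvan f φ
    rw [hcon f, Complex.ofReal_zero] at this
    exact this
  have h1 := (pointwiseRepresentation E).norm_character_apply_le φ
    (a - (toAlgebra E f + Complex.I • toAlgebra E g))
  rw [map_sub, map_add, map_smul, h0, h0, smul_zero, add_zero, sub_zero] at h1
  rw [zero_add]
  exact h1.trans h.le

/-- On the nonnegative elements of `A(B(E))` the extended functional is integration over `X`. -/
theorem IsDirichletForm.extendedIntegral_eq (hE : IsDirichletForm E) (a : uniformAlgebra E)
    (ha : ∀ x, 0 ≤ ((a : lp (fun _ : X => ℂ) ∞) x).re) :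
    extendedIntegral E a = ∫⁻ x, ENNReal.ofReal ((a : lp (fun _ : X => ℂ) ∞) x).re ∂μ := by
  apply le_antisymm
  · exact iSup₂_le fun g hg => lintegral_mono fun x => ENNReal.ofReal_le_ofReal (hg.2 x).2
  · choose f hf hfa using fun n : ℕ =>
      hE.exists_abs_re_sub_le a (Nat.one_div_pos_of_nat (α := ℝ) (n := n))
    -- Lowering by the approximation error puts g n below a, and the positive part keeps it
    -- admissible.
    set g : ℕ → X → ℝ := fun n x => max (f n x - 1 / (n + 1)) 0 with hg
    have hgB : ∀ n, g n ∈ boundedEnergy E := fun n =>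
      hE.posPart_sub_mem_boundedEnergy (hf n) (by positivity)
    have hgle : ∀ n x, g n x ≤ ((a : lp (fun _ : X => ℂ) ∞) x).re := fun n x =>
      max_le (by linarith [(abs_le.mp (hfa n x)).1]) (ha x)
    have hglim : ∀ x, Tendsto (fun n => g n x) atTop (𝓝 ((a : lp (fun _ : X => ℂ) ∞) x).re) := by
      intro x
      have h0 := (tendsto_one_div_add_atTop_nhds_zero_nat (𝕜 := ℝ)).const_mul 2
      have h1 : Tendsto (fun n : ℕ => ((a : lp (fun _ : X => ℂ) ∞) x).re - 2 * (1 / ((n : ℝ) + 1)))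
          atTop (𝓝 ((a : lp (fun _ : X => ℂ) ∞) x).re) := by
        simpa using h0.const_sub ((a : lp (fun _ : X => ℂ) ∞) x).re
      refine tendsto_of_tendsto_of_tendsto_of_le_of_le h1 tendsto_const_nhds (fun n => ?_)
        fun n => hgle n x
      exact le_max_of_le_left (by linarith [(abs_le.mp (hfa n x)).2])
    have hliminf : ∀ x, liminf (fun n => ENNReal.ofReal (g n x)) atTop =
        ENNReal.ofReal ((a : lp (fun _ : X => ℂ) ∞) x).re := fun x =>
      (ENNReal.tendsto_ofReal (hglim x)).liminf_eq
    simp_rw [← hliminf]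
    -- The sequence need not be monotone, so Fatou's lemma is used.
    refine (lintegral_liminf_le fun n => (hgB n).1.ennreal_ofReal).trans ?_
    refine liminf_le_of_le (by isBoundedDefault) fun b hb => ?_
    obtain ⟨n, hn⟩ := hb.exists
    exact hn.trans (le_iSup₂_of_le (g n) ⟨hgB n, fun x => ⟨le_max_right _ _, hgle n x⟩⟩ le_rfl)

/-- The image of `μ` on the spectrum. -/
def spectrumMeasure (hvan : VanishesNowhere (boundedEnergy E)) : Measure (Spectrum E) :=
  μ.map (toSpectrum hvan)

theorem IsDirichletForm.measurePreserving_toSpectrum (hE : IsDirichletForm E)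
    (hvan : VanishesNowhere (boundedEnergy E)) (hsep : SupSeparable (boundedEnergy E)) :
    MeasurePreserving (toSpectrum hvan) μ (spectrumMeasure hvan) :=
  ⟨hE.measurable_toSpectrum hvan hsep, rfl⟩

/-- Near φ some f̂ stays away from zero, and the set where |f| exceeds a positive level has finite
measure because f is integrable. On a second countable locally compact Hausdorff space local
finiteness gives regularity. -/
theorem IsDirichletForm.regular_spectrumMeasure (hE : IsDirichletForm E)
    (hvan : VanishesNowhere (boundedEnergy E)) (hsep : SupSeparable (boundedEnergy E)) :
    (spectrumMeasure hvan).Regular := by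
  have := hE.secondCountableTopology_spectrum hsep
  have := locallyCompactSpace_spectrum E
  have := t2Space_spectrum E
  have : IsLocallyFiniteMeasure (spectrumMeasure hvan) := by
    refine ⟨fun φ => ?_⟩
    obtain ⟨f, hf⟩ := hE.exists_hat_ne_zero hvan φ
    have hopen : IsOpen {ψ | |hat E f φ| / 2 < |hat E f ψ|} :=
      isOpen_lt continuous_const (continuous_hat f).abs
    refine ⟨_, hopen.mem_nhds ?_, ?_⟩
    · exact half_lt_self (abs_pos.mpr hf)
    · rw [spectrumMeasure, Measure.map_apply (hE.measurable_toSpectrum hvan hsep)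
        hopen.measurableSet]
      exact f.2.2.2.1.measure_norm_gt_lt_top (half_pos (abs_pos.mpr hf))
  infer_instance

theorem IsDirichletForm.isTransferredMeasure_spectrumMeasure (hE : IsDirichletForm E)
    (hvan : VanishesNowhere (boundedEnergy E)) (hsep : SupSeparable (boundedEnergy E)) :
    IsTransferredMeasure E (spectrumMeasure hvan) := by
  refine ⟨hE.regular_spectrumMeasure hvan hsep, fun a ha _ => ?_⟩
  rw [hE.extendedIntegral_eq a fun x => (ha x).1]
  exact lintegral_map (f := fun φ => ENNReal.ofReal (gelfand E a φ).re)
    (ENNReal.measurable_ofReal.comp (Complex.measurable_re.comp (continuous_gelfand a).measurable))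
    (hE.measurable_toSpectrum hvan hsep)

/-- Transferred measures are unique. -/
theorem IsTransferredMeasure.unique (hvan : VanishesNowhere (boundedEnergy E))
    {ν ν' : Measure (Spectrum E)} (hν : IsTransferredMeasure E ν)
    (hν' : IsTransferredMeasure E ν') : ν' = ν := by
  have := locallyCompactSpace_spectrum E
  have := t2Space_spectrum E
  have := hν.regular
  have := hν'.regular
  -- Radon measures are compared on C_c(Δ), and each such test function is a Gelfand transform.
  refine Measure.ext_of_integral_eq_on_compactlySupported_nnreal fun f => ?_
  have hfc : Continuous fun φ => ((f φ : ℝ) : ℂ) :=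
    Complex.continuous_ofReal.comp (NNReal.continuous_coe.comp f.continuous)
  have hfs : HasCompactSupport fun φ => ((f φ : ℝ) : ℂ) :=
    f.hasCompactSupport.comp_left (g := fun r : NNReal => ((r : ℝ) : ℂ)) (by simp)
  obtain ⟨a, ha⟩ := (pointwiseRepresentation E).exists_character_apply_eq
    (exists_eval_ne_zero hvan) hfc hfs
  have hga : gelfand E a = fun φ => ((f φ : ℝ) : ℂ) := funext ha
  have hax : ∀ x, (a : lp (fun _ : X => ℂ) ∞) x = ((f (toSpectrum hvan x) : ℝ) : ℂ) :=
    fun x => ha (toSpectrum hvan x)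
  have hpos : ∀ x, 0 ≤ ((a : lp (fun _ : X => ℂ) ∞) x).re ∧
      ((a : lp (fun _ : X => ℂ) ∞) x).im = 0 := fun x => by
    rw [hax]
    exact ⟨NNReal.coe_nonneg _, Complex.ofReal_im _⟩
  have h1 := (hν.represents a hpos (hga ▸ hfs)).trans (hν'.represents a hpos (hga ▸ hfs)).symm
  simp only [hga, Complex.ofReal_re] at h1
  have hmeas : ∀ m : Measure (Spectrum E), AEStronglyMeasurable (fun φ => (f φ : ℝ)) m := fun m =>
    (NNReal.continuous_coe.measurable.comp f.continuous.measurable).aestronglyMeasurable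
  rw [integral_eq_lintegral_of_nonneg_ae (ae_of_all _ fun φ => NNReal.coe_nonneg _) (hmeas _),
    integral_eq_lintegral_of_nonneg_ae (ae_of_all _ fun φ => NNReal.coe_nonneg _) (hmeas _), h1]

end TransferredMeasure

/-! ### Pullback of forms along isometries. -/

namespace SymForm

variable {H H' : Type*} [NormedAddCommGroup H] [NormedSpace ℝ H] [NormedAddCommGroup H']
  [NormedSpace ℝ H']

/-- The pullback of a form along a linear isometry. -/
def comap (E : SymForm H') (J : H →ₗᵢ[ℝ] H') : SymForm H where
  dom := E.dom.comap J.toLinearMap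
  form := E.form.compl₁₂ (J.toLinearMap.restrict fun _ h => h)
    (J.toLinearMap.restrict fun _ h => h)
  symm _ _ := E.symm _ _
  nonneg _ := E.nonneg _

/-- The element of the domain of `E` that corresponds to an element of the domain of its
pullback. -/
def comapApply (E : SymForm H') (J : H →ₗᵢ[ℝ] H') (u : (E.comap J).dom) : E.dom := ⟨J u, u.2⟩

theorem comap_form (E : SymForm H') (J : H →ₗᵢ[ℝ] H') (u v : (E.comap J).dom) :
    (E.comap J).form u v = E.form (E.comapApply J u) (E.comapApply J v) := rfl

theorem comap_energyOne (E : SymForm H') (J : H →ₗᵢ[ℝ] H') (u : (E.comap J).dom) :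
    (E.comap J).energyOne u = E.energyOne (E.comapApply J u) := by
  have : ‖J (u : H)‖ = ‖(u : H)‖ := J.norm_map _
  rw [energyOne, energyOne, comap_form, comapApply, this]

theorem comapApply_sub (E : SymForm H') (J : H →ₗᵢ[ℝ] H') (u v : (E.comap J).dom) :
    E.comapApply J (u - v) = E.comapApply J u - E.comapApply J v :=
  Subtype.ext (map_sub J (u : H) (v : H))

/-- Completeness of H makes the range of J closed, so the E₁-limit comes from H. -/
theorem IsClosed.comap [CompleteSpace H] {E : SymForm H'} (hE : E.IsClosed) (J : H →ₗᵢ[ℝ] H') :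
    (E.comap J).IsClosed := by
  intro u hu
  obtain ⟨v, hv⟩ := hE (fun n => E.comapApply J (u n)) (by
    simpa only [comap_energyOne, comapApply_sub] using hu)
  obtain ⟨w, hw⟩ : (v : H') ∈ range J :=
    J.isometry.isClosedEmbedding.isClosed_range.mem_of_tendsto
      (tendsto_of_tendsto_energyOne hv) (Eventually.of_forall fun n => ⟨(u n : H), rfl⟩)
  have hwd : w ∈ (E.comap J).dom := by
    change J w ∈ E.dom
    rw [hw]
    exact v.2
  refine ⟨⟨w, hwd⟩, ?_⟩
  have : E.comapApply J ⟨w, hwd⟩ = v := Subtype.ext hw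
  simpa only [comap_energyOne, comapApply_sub, this] using hv

/-- The restriction of a form to a smaller domain. -/
def restrict (E : SymForm H) (p : Submodule ℝ H) (hp : p ≤ E.dom) : SymForm H where
  dom := p
  form := E.form.compl₁₂ (Submodule.inclusion hp) (Submodule.inclusion hp)
  symm _ _ := E.symm _ _
  nonneg _ := E.nonneg _

end SymForm

/-! ### The transferred form, its closure and regularity. -/

section TransferredForm

variable {X : Type*} [MeasurableSpace X] {μ : Measure X} {E : SymForm (Lp ℝ 2 μ)}

/-- Functions in `B(E)` whose Gelfand transform has compact support are dense in the domain. -/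
theorem IsDirichletForm.exists_hasCompactSupport_hat_near (hE : IsDirichletForm E)
    (hvan : VanishesNowhere (boundedEnergy E)) (u : E.dom) {ε : ℝ} (hε : 0 < ε) :
    ∃ f : boundedEnergy E, HasCompactSupport (hat E f) ∧ ∃ w : E.dom,
      ((w : Lp ℝ 2 μ) : X → ℝ) =ᵐ[μ] (f : X → ℝ) ∧ E.energyOne (u - w) < ε := by
  set K : Set E.dom := {w | ∃ f : boundedEnergy E, HasCompactSupport (hat E f) ∧
    ((w : Lp ℝ 2 μ) : X → ℝ) =ᵐ[μ] (f : X → ℝ)} with hK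
  have hconv : ∀ v ∈ K, ∀ w ∈ K, (2⁻¹ : ℝ) • (v + w) ∈ K := by
    rintro v ⟨f, hfs, hf⟩ w ⟨g, hgs, hg⟩
    refine ⟨⟨_, smul_mem_boundedEnergy 2⁻¹ (add_mem_boundedEnergy f.2 g.2)⟩, ?_, ?_⟩
    · have heq : hat E ⟨_, smul_mem_boundedEnergy 2⁻¹ (add_mem_boundedEnergy f.2 g.2)⟩ =
          (fun _ => (2⁻¹ : ℝ)) * (hat E f + hat E g) :=
        eq_of_comp_toSpectrum_eq hvan (continuous_hat _)
          (continuous_const.mul ((continuous_hat f).add (continuous_hat g))) fun _ => rfl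
      rw [heq]
      exact (hfs.add hgs).mul_left
    · exact (Lp.coeFn_smul _ _).trans (((Lp.coeFn_add _ _).trans (hf.add hg)).const_smul _)
  -- The energy bound does not depend on δ, so L₂ approximation within the convex set K improves to
  -- E₁ approximation.
  obtain ⟨hu, happ⟩ := hE.isClosed.exists_mem_dom_of_approx hconv (u := (u : Lp ℝ 2 μ))
    (M := 256 * E.form u u) (fun δ hδ => by
    have hsm := Lp.stronglyMeasurable (u : Lp ℝ 2 μ)
    obtain ⟨s, t, hs, hst, w, hw, hwu, hwE⟩ :=
      hE.exists_truncate_truncate_near u (ae_eq_refl _) hδ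
    have h1 := hE.truncate_dom_mem_boundedEnergy u hsm.measurable (ae_eq_refl _) hs hst
    exact ⟨w, ⟨_, hE.hasCompactSupport_hat_truncate hvan ⟨_, h1⟩ hs hst, hw⟩, hwu, hwE⟩)
  obtain ⟨w, ⟨f, hfs, hf⟩, hwε⟩ := happ ε hε
  exact ⟨f, hfs, w, hf, hwε⟩

theorem memLp_of_mem_boundedEnergy {f : X → ℝ} (hf : f ∈ boundedEnergy E) : MemLp f 2 μ := by
  obtain ⟨-, -, -, u, hu⟩ := hf
  exact (memLp_congr_ae hu).mp (Lp.memLp _)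

section Transfer

variable {hvan : VanishesNowhere (boundedEnergy E)} {ν : Measure (Spectrum E)}

theorem memLp_hat (hι : MeasurePreserving (toSpectrum hvan) μ ν) (f : boundedEnergy E) :
    MemLp (hat E f) 2 ν := by
  rw [← hι.map_eq, memLp_map_measure_iff (continuous_hat f).aestronglyMeasurable
    hι.measurable.aemeasurable]
  exact memLp_of_mem_boundedEnergy f.2

/-- The isometry `L₂(Δ) → L₂(X)` given by composition with the canonical map. -/
def pullback (hι : MeasurePreserving (toSpectrum hvan) μ ν) : Lp ℝ 2 ν →ₗᵢ[ℝ] Lp ℝ 2 μ :=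
  Lp.compMeasurePreservingₗᵢ ℝ (toSpectrum hvan) hι

theorem coeFn_pullback (hι : MeasurePreserving (toSpectrum hvan) μ ν) (u : Lp ℝ 2 ν) :
    (pullback hι u : X → ℝ) =ᵐ[μ] fun x => u (toSpectrum hvan x) :=
  Lp.coeFn_compMeasurePreserving u hι

theorem pullback_ae_eq_of_ae_eq (hι : MeasurePreserving (toSpectrum hvan) μ ν) {u : Lp ℝ 2 ν}
    {h : Spectrum E → ℝ} (hu : (u : Spectrum E → ℝ) =ᵐ[ν] h) :
    (pullback hι u : X → ℝ) =ᵐ[μ] fun x => h (toSpectrum hvan x) :=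
  (coeFn_pullback hι u).trans (hι.quasiMeasurePreserving.ae_eq_comp hu)

/-- Classes of functions in B(E) thus lie in the range of the isometry, which is how approximations
found on X return to Δ. -/
theorem pullback_hat (hι : MeasurePreserving (toSpectrum hvan) μ ν) (f : boundedEnergy E)
    {w : Lp ℝ 2 μ} (hw : (w : X → ℝ) =ᵐ[μ] (f : X → ℝ)) :
    pullback hι ((memLp_hat hι f).toLp _) = w :=
  Lp.ext ((pullback_ae_eq_of_ae_eq hι (memLp_hat hι f).coeFn_toLp).trans hw.symm)

/-- The classes of the Gelfand transforms of the functions in `B(E)`. -/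
def hatSubmodule (hvan : VanishesNowhere (boundedEnergy E)) (ν : Measure (Spectrum E)) :
    Submodule ℝ (Lp ℝ 2 ν) where
  carrier := {u | ∃ f : boundedEnergy E, (u : Spectrum E → ℝ) =ᵐ[ν] hat E f}
  add_mem' := by
    rintro u v ⟨f, hf⟩ ⟨g, hg⟩
    refine ⟨⟨_, add_mem_boundedEnergy f.2 g.2⟩, (Lp.coeFn_add u v).trans ((hf.add hg).trans ?_)⟩
    exact ae_of_all _ fun φ => congrFun (eq_of_comp_toSpectrum_eq hvan
      ((continuous_hat f).add (continuous_hat g)) (continuous_hat _) fun _ => rfl) φ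
  zero_mem' := by
    refine ⟨⟨_, zero_mem_boundedEnergy E⟩, (Lp.coeFn_zero ℝ 2 ν).trans ?_⟩
    exact ae_of_all _ fun φ => congrFun (eq_of_comp_toSpectrum_eq hvan
      continuous_zero (continuous_hat _) fun _ => rfl) φ
  smul_mem' := by
    rintro c u ⟨f, hf⟩
    refine ⟨⟨_, smul_mem_boundedEnergy c f.2⟩,
      (Lp.coeFn_smul c u).trans ((hf.const_smul c).trans ?_)⟩
    exact ae_of_all _ fun φ => congrFun (eq_of_comp_toSpectrum_eq hvan
      ((continuous_hat f).const_smul c) (continuous_hat _) fun _ => rfl) φ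

theorem toLp_hat_mem_hatSubmodule (hι : MeasurePreserving (toSpectrum hvan) μ ν)
    (f : boundedEnergy E) : (memLp_hat hι f).toLp _ ∈ hatSubmodule hvan ν :=
  ⟨f, (memLp_hat hι f).coeFn_toLp⟩

theorem hatSubmodule_le (hι : MeasurePreserving (toSpectrum hvan) μ ν) :
    hatSubmodule hvan ν ≤ (E.comap (pullback hι)).dom := by
  rintro u ⟨f, hf⟩
  obtain ⟨w, hw⟩ := f.2.2.2.2
  have : pullback hι u = w := Lp.ext ((pullback_ae_eq_of_ae_eq hι hf).trans hw.symm)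
  change pullback hι u ∈ E.dom
  rw [this]
  exact w.2

/-- The transferred form. -/
def transferredForm (hι : MeasurePreserving (toSpectrum hvan) μ ν) : SymForm (Lp ℝ 2 ν) :=
  (E.comap (pullback hι)).restrict (hatSubmodule hvan ν) (hatSubmodule_le hι)

theorem isTransferredForm_transferredForm (hι : MeasurePreserving (toSpectrum hvan) μ ν) :
    IsTransferredForm E (transferredForm hι) where
  exists_class f := ⟨⟨_, toLp_hat_mem_hatSubmodule hι f⟩, (memLp_hat hι f).coeFn_toLp⟩
  mem_dom u := Iff.rfl
  form_eq f g u v p q hu hv hp hq := by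
    -- The class of f̂ determines that of f through the isometry; this is the well-definedness of
    -- the form.
    have h1 : pullback hι (u : Lp ℝ 2 ν) = p :=
      Lp.ext ((pullback_ae_eq_of_ae_eq hι hu).trans hp.symm)
    have h2 : pullback hι (v : Lp ℝ 2 ν) = q :=
      Lp.ext ((pullback_ae_eq_of_ae_eq hι hv).trans hq.symm)
    have h3 : E.comapApply (pullback hι) ⟨u, hatSubmodule_le hι u.2⟩ = p := Subtype.ext h1
    have h4 : E.comapApply (pullback hι) ⟨v, hatSubmodule_le hι v.2⟩ = q := Subtype.ext h2
    rw [← h3, ← h4]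
    rfl

/-- Approximation in the domain of the pullback by Gelfand transforms of compact support. -/
theorem IsDirichletForm.exists_hat_near (hE : IsDirichletForm E)
    (hι : MeasurePreserving (toSpectrum hvan) μ ν) (u : (E.comap (pullback hι)).dom) {ε : ℝ}
    (hε : 0 < ε) : ∃ f : boundedEnergy E, HasCompactSupport (hat E f) ∧
      (E.comap (pullback hι)).energyOne
        (u - ⟨_, hatSubmodule_le hι (toLp_hat_mem_hatSubmodule hι f)⟩) < ε := by
  obtain ⟨f, hfs, w, hw, hwε⟩ :=
    hE.exists_hasCompactSupport_hat_near hvan (E.comapApply (pullback hι) u) hε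
  refine ⟨f, hfs, ?_⟩
  have : E.comapApply (pullback hι)
      ⟨_, hatSubmodule_le hι (toLp_hat_mem_hatSubmodule hι f)⟩ = w :=
    Subtype.ext (pullback_hat hι f hw)
  rwa [SymForm.comap_energyOne, SymForm.comapApply_sub, this]

theorem IsDirichletForm.isClosureOf_transferredForm (hE : IsDirichletForm E)
    (hι : MeasurePreserving (toSpectrum hvan) μ ν) :
    (E.comap (pullback hι)).IsClosureOf (transferredForm hι) where
  isClosed := hE.isClosed.comap _
  dom_le := hatSubmodule_le hι
  form_eq _ _ := rfl
  dense u _ hε :=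
    let ⟨f, _, hf⟩ := hE.exists_hat_near hι u hε
    ⟨⟨_, toLp_hat_mem_hatSubmodule hι f⟩, hf⟩

/-- Composition with ι commutes with the unit contraction, so the contraction property passes to the
pullback. Density is measured in L₂(X) through the isometry. -/
theorem IsDirichletForm.isDirichletForm_comap (hE : IsDirichletForm E)
    (hι : MeasurePreserving (toSpectrum hvan) μ ν) :
    IsDirichletForm (E.comap (pullback hι)) where
  dense := by
    intro h
    rw [Metric.mem_closure_iff]
    intro ε hε
    obtain ⟨p, hp, hhp⟩ := Metric.mem_closure_iff.mp (hE.dense (pullback hι h)) (ε / 2)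
      (half_pos hε)
    obtain ⟨f, -, w, hw, hwε⟩ :=
      hE.exists_hasCompactSupport_hat_near hvan ⟨p, hp⟩ (sq_pos_of_pos (half_pos hε))
    refine ⟨_, hatSubmodule_le hι (toLp_hat_mem_hatSubmodule hι f), ?_⟩
    rw [← (pullback hι).isometry.dist_eq, pullback_hat hι f hw]
    have h1 := (E.norm_sq_le_energyOne (⟨p, hp⟩ - w)).trans_lt hwε
    have h2 : dist p (w : Lp ℝ 2 μ) < ε / 2 := by
      rw [dist_eq_norm]
      exact lt_of_pow_lt_pow_left₀ 2 (half_pos hε).le h1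
    linarith [dist_triangle (pullback hι h) p (w : Lp ℝ 2 μ)]
  isClosed := hE.isClosed.comap _
  markov u v hv := hE.markov (E.comapApply _ u) (pullback hι v) (by
    filter_upwards [pullback_ae_eq_of_ae_eq hι hv, coeFn_pullback hι (u : Lp ℝ 2 ν)] with x h1 h2
    rw [h1, SymForm.comapApply, h2])

/-- Write h as a Gelfand transform â, approximate Re a by f in B(E) up to ε/4, and truncate f at ε/4
to obtain compact support. The total error is at most ε/2 on X, hence on Δ by density. -/
theorem IsDirichletForm.exists_hat_sup_near (hE : IsDirichletForm E)
    (hvan : VanishesNowhere (boundedEnergy E)) {h : Spectrum E → ℝ} (hc : Continuous h)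
    (hs : HasCompactSupport h) {ε : ℝ} (hε : 0 < ε) :
    ∃ f : boundedEnergy E, HasCompactSupport (hat E f) ∧ ∀ φ, |h φ - hat E f φ| < ε := by
  have hcc : Continuous fun φ => (h φ : ℂ) := Complex.continuous_ofReal.comp hc
  have hcs : HasCompactSupport fun φ => (h φ : ℂ) :=
    hs.comp_left (g := Complex.ofReal) Complex.ofReal_zero
  obtain ⟨a, ha⟩ := (pointwiseRepresentation E).exists_character_apply_eq
    (exists_eval_ne_zero hvan) hcc hcs
  obtain ⟨f, hf, hfa⟩ := hE.exists_abs_re_sub_le a (show 0 < ε / 4 by positivity)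
  obtain ⟨M, hM⟩ := hf.2.1
  -- The upper level lies above |f|, so only the cut near zero changes f.
  have hst : ε / 4 ≤ max M (ε / 4) := le_max_right _ _
  refine ⟨_, hE.hasCompactSupport_hat_truncate hvan ⟨f, hf⟩ (show 0 < ε / 4 by positivity) hst,
    fun φ => lt_of_le_of_lt ?_ (half_lt_self hε)⟩
  refine (denseRange_toSpectrum hvan).induction_on φ
    (isClosed_le (hc.sub (continuous_hat _)).abs continuous_const) fun x => ?_
  rw [hat_toSpectrum]
  have h1 : ((a : lp (fun _ : X => ℂ) ∞) x).re = h (toSpectrum hvan x) := by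
    have : (a : lp (fun _ : X => ℂ) ∞) x = (h (toSpectrum hvan x) : ℂ) := ha (toSpectrum hvan x)
    rw [this, Complex.ofReal_re]
  have h2 := hfa x
  rw [h1] at h2
  have h3 := abs_sub_truncate_le (show 0 < ε / 4 by positivity) hst
    ((hM x).trans (le_max_left M (ε / 4)))
  rw [abs_le] at h2 h3 ⊢
  constructor <;> linarith

theorem IsDirichletForm.isRegularForm_comap (hE : IsDirichletForm E)
    (hι : MeasurePreserving (toSpectrum hvan) μ ν) :
    IsRegularForm (E.comap (pullback hι)) where
  dense_dom u _ hε :=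
    let ⟨f, hfs, hf⟩ := hE.exists_hat_near hι u hε
    ⟨hat E f, continuous_hat f, hfs, _, (memLp_hat hι f).coeFn_toLp, hf⟩
  dense_sup _ hc hs _ hε :=
    let ⟨f, hfs, hf⟩ := hE.exists_hat_sup_near hvan hc hs hε
    ⟨hat E f, continuous_hat f, hfs,
      ⟨⟨_, hatSubmodule_le hι (toLp_hat_mem_hatSubmodule hι f)⟩,
        (memLp_hat hι f).coeFn_toLp⟩, hf⟩

end Transfer

end TransferredForm

end GelfandDirichlet

end

theorem theorem5p1 {X : Type*} [MeasurableSpace X] (μ : MeasureTheory.Measure X)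
    (E : GelfandDirichlet.SymForm (MeasureTheory.Lp ℝ 2 μ))
    (hE : GelfandDirichlet.IsDirichletForm E)
    (hvan : GelfandDirichlet.VanishesNowhere (GelfandDirichlet.boundedEnergy E))
    (hsep : GelfandDirichlet.SupSeparable (GelfandDirichlet.boundedEnergy E)) :
    (GelfandDirichlet.uniformAlgebra E : Set (lp (fun _ : X => ℂ) ∞)) =
        closure (GelfandDirichlet.complexification E) ∧
      T2Space (GelfandDirichlet.Spectrum E) ∧
      LocallyCompactSpace (GelfandDirichlet.Spectrum E) ∧
      SecondCountableTopology (GelfandDirichlet.Spectrum E) ∧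
      ∃ ν : MeasureTheory.Measure (GelfandDirichlet.Spectrum E),
        GelfandDirichlet.IsTransferredMeasure E ν ∧
        (∀ ν' : MeasureTheory.Measure (GelfandDirichlet.Spectrum E),
          GelfandDirichlet.IsTransferredMeasure E ν' → ν' = ν) ∧
        ∃ T : GelfandDirichlet.SymForm (MeasureTheory.Lp ℝ 2 ν),
          GelfandDirichlet.IsTransferredForm E T ∧
          T.IsClosable ∧
          ∃ C : GelfandDirichlet.SymForm (MeasureTheory.Lp ℝ 2 ν),
            C.IsClosureOf T ∧
            GelfandDirichlet.IsDirichletForm C ∧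
            GelfandDirichlet.IsRegularForm C := by
  have hν := hE.isTransferredMeasure_spectrumMeasure hvan hsep
  have hι := hE.measurePreserving_toSpectrum hvan hsep
  have hC := hE.isClosureOf_transferredForm hι
  -- The closure is the full pullback of E, and closability follows from the existence of this
  -- closed extension.
  exact ⟨hE.coe_uniformAlgebra, GelfandDirichlet.t2Space_spectrum E,
    GelfandDirichlet.locallyCompactSpace_spectrum E, hE.secondCountableTopology_spectrum hsep,
    _, hν, fun ν' hν' => hν.unique hvan hν', _,
    GelfandDirichlet.isTransferredForm_transferredForm hι,
    GelfandDirichlet.SymForm.IsClosable.of_isClosed hC.isClosed hC.dom_le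
      fun u => hC.form_eq u u,
    _, hC, hE.isDirichletForm_comap hι, hE.isRegularForm_comap hι⟩
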